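/- **Setting.** Write $\mathbb R^n$-valued sequences of length $T$ as $\mathbf u=(\mathbf u[1],\dots,\mathbf u[T])$, with $\|\mathbf u\|_{\ell^2_T}^2=\sum_k\|\mathbf u[k]\|_2^2$. A *state-space model* (SSM) $\Sigma=(A,B,C,D)$ is the system $\mathbf x[k+1]=A\mathbf x[k]+B\mathbf u[k]$, $\mathbf x[1]=0$, $\mathbf y[k]=C\mathbf x[k]+D\mathbf u[k]$ with input dimension $n_u$, output dimension $n_y$ and any state dimension; $\mathcal S_\Sigma$ denotes its map $\mathbf u\mapsto\mathbf y$. It is *internally stable* if all eigenvalues of $A$ lie in the open complex unit disk. Put $$\|\Sigma\|_1=\max_i\Big[\|D_i\|_1+\sum_{k\ge0}\|C_iA^kB\|_1\Big],\qquad \|\Sigma\|_2=\Big(\|D\|_F^2+\sum_{k\ge0}\|CA^kB\|_F^2\Big)^{1/2},$$ where $D_i$, $C_i$ denote $i$th rows. An admissible *sigmoid* is a $1$-Lipschitz function $\rho:\mathbb R\to[-1,1]$ with $\rho(0)=1/2$ and $\rho-\rho(0)$ odd (for example the logistic function). An *MLP layer* with $M$ hidden layers of arbitrary widths applies, at each time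 step, $x\mapsto g_{M+1}\circ(\rho\circ g_M)\circ\dots\circ(\rho\circ g_1)(x)$ with $g_j(x)=W_jx+\mathbf b_j$ and $\rho$ acting entrywise. A *GLU layer* applies, at each time step, $x\mapsto \mathrm{GELU}(x)\odot\sigma(W\,\mathrm{GELU}(x))$, where $\mathrm{GELU}(x)=x\Phi(x)$ entrywise and $\Phi$ is the standard normal distribution function. A *deep SSM model* of depth $L$ with scalar output is $f=f^{\rm Dec}\circ f^{\rm Pool}\circ f^{B_L}\circ\dots\circ f^{B_1}\circ f^{\rm Enc}$, where $f^{\rm Enc}(\mathbf u)[k]=W_{\rm Enc}\mathbf u[k]\in\mathbb R^{n_u}$, $f^{B_i}(\mathbf u)[k]=g_i(\mathcal S_{\Sigma_i}(\mathbf u)[k])+\alpha_i\mathbf u[k]$ with an SSM $\Sigma_i$ and an MLP or GLU layer $g_i$, $f^{\rm Pool}(\mathbf u)=\frac1T\sum_{k=1}^T\mathbf u[k]$, and $f^{\rm Dec}(x)=W_{\rm Dec}x\in\mathbb R$. **Assumptions.** $\mathcal F$ is a set of such models of depth $L$ with common residual weights $\alpha_1,\dots,\alpha_L$. For all models in $\mathcal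 F$ the encoder and decoder matrices have spectral norm $<K_{\rm Enc}$ and $<K_{\rm Dec}$; all SSMs are internally stable with $\|\Sigma\|_1\le K_1$ and $\|\Sigma\|_2\le K_2$. For each $i$, either all $g_i$ are MLP layers with the same number $M_i\ge1$ of hidden layers and the same activation $\rho_i$ (ReLU or an admissible sigmoid), with $\|W_j\|_{\infty,\infty}<K_{W,i}$ and $\|\mathbf b_j\|_\infty<K_{\mathbf b,i}$ for all $j$, or all $g_i$ are GLU layers with the same admissible sigmoid $\sigma_i$ and $\|W\|_{\infty,\infty}<K_{{\rm GLU},i}$. The loss $\ell:\mathbb R\times\mathbb R\to[0,\infty)$ satisfies $\ell(y,y')=0$ iff $y=y'$ and $\ell(y_1,y_1')-\ell(y_2,y_2')\le L_\ell(|y_1-y_2|+|y_1'-y_2'|)$. The data distribution $\mathcal D$ is a Borel probability measure on $\mathbb R^{n_{\rm in}T}\times\mathbb R$ such that almost surely $\|\mathbf u\|_{\ell^2_T}\le K_{\mathbf u}$ and $|y|\le K_y$. Let $\mathcal L(f)=\mathbb E_{(\mathbf u,y)\sim\mathcal D}[\ell(f(\mathbf u),y)]$ and, for $S=\{(\mathbf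 u_i,y_i)\}_{i=1}^N$, $\mathcal L^S_{emp}(f)=\frac1N\sum_{i=1}^N\ell(f(\mathbf u_i),y_i)$. **Corollary 1.** There are constants $K_{\mathcal F},K_l\ge0$ that depend only on $L$, $n_u$, the $\alpha_i$, $K_{\rm Enc}$, $K_{\rm Dec}$, $K_1$, $K_2$, the kinds of the nonlinear layers with their $M_i$, $K_{W,i}$, $K_{\mathbf b,i}$, $K_{{\rm GLU},i}$, and on $L_\ell$, $K_{\mathbf u}$, $K_y$ (in particular not on $T$, $N$, $\delta$, $\mathcal D$) such that, under the assumptions above, for all $T\ge1$, $N\ge1$ and $\delta>0$, with probability at least $1-\delta$ over $S\sim\mathcal D^N$, every empirical risk minimizer $f_{\rm ERM}\in\arg\min_{f\in\mathcal F}\mathcal L^S_{emp}(f)$ satisfies $$\mathcal L(f_{\rm ERM})\le\inf_{f\in\mathcal F}\mathcal L(f)+\frac{K_{\mathcal F}+5K_l\sqrt{2\log(8/\delta)}}{\sqrt N}.$$ -/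

import Mathlib

open MeasureTheory ProbabilityTheory
open scoped ENNReal Matrix

noncomputable section

namespace DeepSSM

/-- Sequences of length `T` of vectors in `ℝⁿ`. -/
abbrev Sequence (T n : ℕ) : Type := Fin T → Fin n → ℝ

/-- The norm of `ℓ²_T(ℝⁿ)`. -/
def l2SeqNorm {T n : ℕ} (u : Sequence T n) : ℝ :=
  Real.sqrt (∑ k, ∑ j, (u k j) ^ 2)

/-! Matrix norms. -/

/-- The operator norm of a matrix between Euclidean spaces. -/
def norm22 {m n : ℕ} (W : Matrix (Fin m) (Fin n) ℝ) : ℝ :=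
  @norm _ Matrix.instL2OpNormedAddCommGroup.toNorm W

/-- The operator norm of a matrix between spaces with the supremum norm (maximal absolute row
sum). -/
def normInfInf {m n : ℕ} (W : Matrix (Fin m) (Fin n) ℝ) : ℝ :=
  @norm _ Matrix.linftyOpNormedAddCommGroup.toNorm W

/-- The sum of the absolute values of the entries of the `i`-th row, as an extended real. -/
def rowL1 {m n : ℕ} (W : Matrix (Fin m) (Fin n) ℝ) (i : Fin m) : ℝ≥0∞ :=
  ENNReal.ofReal (∑ j, |W i j|)

/-- The squared Frobenius norm, as an extended real. -/
def frobSq {m n : ℕ} (W : Matrix (Fin m) (Fin n) ℝ) : ℝ≥0∞ :=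
  ENNReal.ofReal (∑ i, ∑ j, (W i j) ^ 2)

/-! State-space models. -/

/-- A discrete-time linear system `x[k+1] = A x[k] + B u[k]`, `y[k] = C x[k] + D u[k]` with `nu`
inputs, `ny` outputs and an arbitrary number `nx` of states. -/
structure SSM (nu ny : ℕ) where
  nx : ℕ
  A : Matrix (Fin nx) (Fin nx) ℝ
  B : Matrix (Fin nx) (Fin nu) ℝ
  C : Matrix (Fin ny) (Fin nx) ℝ
  D : Matrix (Fin ny) (Fin nu) ℝ

namespace SSM

variable {nu ny T : ℕ}

/-- Internal stability: `A` is a Schur matrix, all its complex eigenvalues lie in the open unit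
disk. -/
def InternallyStable (S : SSM nu ny) : Prop :=
  ∀ z ∈ spectrum ℂ (S.A.map (fun a : ℝ => (a : ℂ))), ‖z‖ < 1

/-- The state after `k` steps, started in `0`. Times are counted from `0`; only the inputs at times
`< T` are ever used. -/
def state (S : SSM nu ny) (u : Sequence T nu) : ℕ → (Fin S.nx → ℝ)
  | 0 => 0
  | k + 1 => S.A *ᵥ state S u k + S.B *ᵥ (if h : k < T then u ⟨k, h⟩ else 0)

/-- The input-output map on sequences of length `T`. -/
def ioMap (S : SSM nu ny) (u : Sequence T nu) : Sequence T ny :=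
  fun k => S.C *ᵥ S.state u k + S.D *ᵥ u k

/-- The `ℓ₁` norm `max_i (‖D_i‖₁ + ∑_k ‖C_i Aᵏ B‖₁)`, with values in `[0, ∞]`. -/
def norm1 (S : SSM nu ny) : ℝ≥0∞ :=
  ⨆ i : Fin ny, (rowL1 S.D i + ∑' k : ℕ, rowL1 (S.C * S.A ^ k * S.B) i)

/-- The `H₂` norm `(‖D‖_F² + ∑_k ‖C Aᵏ B‖_F²)^(1/2)`, with values in `[0, ∞]`. -/
def norm2 (S : SSM nu ny) : ℝ≥0∞ :=
  (frobSq S.D + ∑' k : ℕ, frobSq (S.C * S.A ^ k * S.B)) ^ (1 / 2 : ℝ)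

end SSM

/-! Nonlinear layers. -/

/-- The rectified linear unit. -/
def relu (x : ℝ) : ℝ := max x 0

/-- The Gaussian error linear unit `x Φ(x)`, `Φ` the distribution function of the standard normal
law. -/
def gelu (x : ℝ) : ℝ := x * cdf (gaussianReal 0 1) x

/-- The sigmoid functions that are admitted. The logistic function is one of them. -/
structure IsSigmoid (ρ : ℝ → ℝ) : Prop where
  zero : ρ 0 = 1 / 2
  lipschitz : LipschitzWith 1 ρ
  range : ∀ x, ρ x ∈ Set.Icc (-1 : ℝ) 1
  odd : ∀ x, ρ (-x) - ρ 0 = -(ρ x - ρ 0)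

/-- The weights of a network with `M` hidden layers of arbitrary widths, followed by an affine output
layer; `m` is the input dimension and `n` the output dimension. -/
inductive MLPWeights : ℕ → ℕ → ℕ → Type
  | output {m n : ℕ} (W : Matrix (Fin n) (Fin m) ℝ) (b : Fin n → ℝ) : MLPWeights 0 m n
  | hidden {M m h n : ℕ} (W : Matrix (Fin h) (Fin m) ℝ) (b : Fin h → ℝ)
      (rest : MLPWeights M h n) : MLPWeights (M + 1) m n

/-- The function computed by the network with activation function `ρ`. -/
def MLPWeights.eval (ρ : ℝ → ℝ) : {M m n : ℕ} → MLPWeights M m n → (Fin m → ℝ) → (Fin n → ℝ)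
  | _, _, _, .output W b, x => W *ᵥ x + b
  | _, _, _, .hidden W b rest, x => rest.eval ρ (fun j => ρ ((W *ᵥ x + b) j))

/-- All weight matrices have norm `< KW` and all biases have norm `< Kb`, in the supremum norms. -/
def MLPWeights.Bounded (KW Kb : ℝ) : {M m n : ℕ} → MLPWeights M m n → Prop
  | _, _, _, .output W b => normInfInf W < KW ∧ ‖b‖ < Kb
  | _, _, _, .hidden W b rest => normInfInf W < KW ∧ ‖b‖ < Kb ∧ rest.Bounded KW Kb

/-- A nonlinear layer, applied at each time step: an MLP with its activation function, or a gated
linear unit with its sigmoid function (which needs equal input and output dimensions). -/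
inductive NonlinearLayer (ny nu : ℕ) : Type
  | mlp (ρ : ℝ → ℝ) (M : ℕ) (w : MLPWeights M ny nu)
  | glu (σ : ℝ → ℝ) (h : nu = ny) (W : Matrix (Fin nu) (Fin ny) ℝ)

/-- The function `ℝ^{ny} → ℝ^{nu}` of a layer; for a gated linear unit this is
`x ↦ GELU(x) ⊙ σ(W GELU(x))`. -/
def NonlinearLayer.eval {ny nu : ℕ} : NonlinearLayer ny nu → (Fin ny → ℝ) → (Fin nu → ℝ)
  | .mlp ρ _ w, x => w.eval ρ x
  | .glu σ h W, x => fun j => gelu (x (Fin.cast h j)) * σ ((W *ᵥ fun i => gelu (x i)) j)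

/-! Deep SSM models. -/

/-- An SSM block: an SSM, a nonlinear layer and a residual weight. -/
structure Block (nu ny : ℕ) where
  ssm : SSM nu ny
  layer : NonlinearLayer ny nu
  α : ℝ

/-- The block as a map on sequences, `u ↦ (k ↦ g(S(u)[k]) + α u[k])`. -/
def Block.eval {nu ny T : ℕ} (b : Block nu ny) (u : Sequence T nu) : Sequence T nu :=
  fun k => b.layer.eval (b.ssm.ioMap u k) + b.α • u k

/-- Time-average pooling. -/
def pool {T n : ℕ} (u : Sequence T n) : Fin n → ℝ :=
  fun j => (1 / (T : ℝ)) * ∑ k, u k j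

/-- A deep SSM model with `L` blocks: encoder matrix, blocks and decoder matrix. -/
structure Model (nin nu ny nout L : ℕ) where
  enc : Matrix (Fin nu) (Fin nin) ℝ
  block : Fin L → Block nu ny
  dec : Matrix (Fin nout) (Fin nu) ℝ

/-- The input-output map `Dec ∘ Pool ∘ B_L ∘ ⋯ ∘ B_1 ∘ Enc` on sequences of length `T`. -/
def Model.eval {nin nu ny nout L T : ℕ} (f : Model nin nu ny nout L) (u : Sequence T nin) :
    Fin nout → ℝ :=
  f.dec *ᵥ pool (Fin.foldl L (fun v i => (f.block i).eval v) (fun k => f.enc *ᵥ u k))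

/-! The model class. -/

/-- The kind of a family of nonlinear layers, with the bounds on its weights: networks with `M`
hidden layers, or gated linear units. -/
inductive LayerBounds : Type
  | mlp (M : ℕ) (KW Kb : ℝ)
  | glu (KGLU : ℝ)

/-- A nonlinear layer is of the prescribed kind, has the (activation or sigmoid) function `ρ` and
respects the weight bounds. -/
def NonlinearLayer.Respects {ny nu : ℕ} (ρ : ℝ → ℝ) :
    LayerBounds → NonlinearLayer ny nu → Prop
  | .mlp M KW Kb, .mlp ρ' M' w => M' = M ∧ ρ' = ρ ∧ w.Bounded KW Kb
  | .glu KGLU, .glu σ _ W => σ = ρ ∧ normInfInf W < KGLU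
  | _, _ => False

/-- The function `ρ` is admissible for the kind of layer: ReLU or a sigmoid function for networks
(which have at least one hidden layer), a sigmoid function for gated linear units. -/
def LayerBounds.Admissible (ρ : ℝ → ℝ) : LayerBounds → Prop
  | .mlp M _ _ => 1 ≤ M ∧ (ρ = relu ∨ IsSigmoid ρ)
  | .glu _ => IsSigmoid ρ

/-- The numerical parameters of a model class of depth `L`: bounds on encoders and decoders, bounds
on the two norms of the SSMs, and for each block its residual weight and the kind and the weight
bounds of its nonlinear layer. -/
structure ClassParams (L : ℕ) where
  KEnc : ℝ
  KDec : ℝ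
  K1 : ℝ
  K2 : ℝ
  α : Fin L → ℝ
  layer : Fin L → LayerBounds

/-- Families of components: encoders, decoders, SSMs, and nonlinear layers for each block. -/
structure Families (nin nu ny nout L : ℕ) where
  encoders : Set (Matrix (Fin nu) (Fin nin) ℝ)
  decoders : Set (Matrix (Fin nout) (Fin nu) ℝ)
  ssms : Set (SSM nu ny)
  layers : Fin L → Set (NonlinearLayer ny nu)

/-- The assumptions on the families of components: encoders and decoders are bounded, all SSMs are
internally stable with bounded `ℓ₁` and `H₂` norms, and in each block the nonlinear layers are of the
same kind, with the same function `ρ i` and bounded weights. -/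
structure Families.Satisfies {nin nu ny nout L : ℕ} (𝓕 : Families nin nu ny nout L)
    (P : ClassParams L) (ρ : Fin L → ℝ → ℝ) : Prop where
  encoder_lt : ∀ W ∈ 𝓕.encoders, norm22 W < P.KEnc
  decoder_lt : ∀ W ∈ 𝓕.decoders, norm22 W < P.KDec
  stable : ∀ S ∈ 𝓕.ssms, S.InternallyStable
  norm1_le : ∀ S ∈ 𝓕.ssms, S.norm1 ≤ ENNReal.ofReal P.K1
  norm2_le : ∀ S ∈ 𝓕.ssms, S.norm2 ≤ ENNReal.ofReal P.K2
  admissible : ∀ i, (P.layer i).Admissible (ρ i)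
  respects : ∀ i, ∀ g ∈ 𝓕.layers i, NonlinearLayer.Respects (ρ i) (P.layer i) g

/-- All models with components from the given families and with residual weights `α`. -/
def Families.models {nin nu ny nout L : ℕ} (𝓕 : Families nin nu ny nout L) (α : Fin L → ℝ) :
    Set (Model nin nu ny nout L) :=
  {f | f.enc ∈ 𝓕.encoders ∧ f.dec ∈ 𝓕.decoders ∧
    ∀ i, (f.block i).ssm ∈ 𝓕.ssms ∧ (f.block i).layer ∈ 𝓕.layers i ∧ (f.block i).α = α i}

/-! The learning problem, for models with scalar output. -/

/-- A nonnegative elementwise loss that vanishes exactly on the diagonal and is `Lℓ`-Lipschitz. -/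
structure IsLipschitzLoss (ℓ : ℝ → ℝ → ℝ) (Lℓ : ℝ) : Prop where
  nonneg : ∀ y y', 0 ≤ ℓ y y'
  eq_zero_iff : ∀ y y', ℓ y y' = 0 ↔ y = y'
  lipschitz : ∀ y₁ y₁' y₂ y₂', ℓ y₁ y₁' - ℓ y₂ y₂' ≤ Lℓ * (|y₁ - y₂| + |y₁' - y₂'|)

/-- The loss of the model `f` on a labelled sequence. -/
def sampleLoss {nin nu ny L T : ℕ} (ℓ : ℝ → ℝ → ℝ) (f : Model nin nu ny 1 L)
    (p : Sequence T nin × ℝ) : ℝ :=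
  ℓ (f.eval p.1 0) p.2

/-- The true loss with respect to the distribution `D` of labelled sequences. -/
def trueLoss {nin nu ny L T : ℕ} (ℓ : ℝ → ℝ → ℝ) (D : Measure (Sequence T nin × ℝ))
    (f : Model nin nu ny 1 L) : ℝ :=
  ∫ p, sampleLoss ℓ f p ∂D

/-- The empirical loss on the data set `S`. -/
def empLoss {nin nu ny L T N : ℕ} (ℓ : ℝ → ℝ → ℝ) (S : Fin N → Sequence T nin × ℝ)
    (f : Model nin nu ny 1 L) : ℝ :=
  (1 / (N : ℝ)) * ∑ i, sampleLoss ℓ f (S i)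

/-- The model `f` is an empirical risk minimizer over the class `F` on the data set `S`. -/
def IsERM {nin nu ny L T N : ℕ} (ℓ : ℝ → ℝ → ℝ) (F : Set (Model nin nu ny 1 L))
    (S : Fin N → Sequence T nin × ℝ) (f : Model nin nu ny 1 L) : Prop :=
  f ∈ F ∧ ∀ g ∈ F, empLoss ℓ S f ≤ empLoss ℓ S g

/-- Inputs and labels are bounded almost surely. -/
def BoundedData {nin T : ℕ} (D : Measure (Sequence T nin × ℝ)) (Ku Ky : ℝ) : Prop :=
  ∀ᵐ p ∂D, l2SeqNorm p.1 ≤ Ku ∧ |p.2| ≤ Ky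

end DeepSSM

end

/-!
The constants come from exponential moments of Rademacher suprema. For a class of vectors
`a t ∈ ℝᴺ`, the predicate `RadBound C r a` says that `sup_t |∑ i, ± a t i|`, over uniformly random
signs, has exponential moments at most `C exp (N (l r)²)` for all `l ≥ 0`. It is propagated through
a model one operation at a time, with `C` and `r` changing by amounts that depend only on the bounds
of the model class.

* Encoded inputs (`seqBound_encoder`): the suprema are at most the norm of a Rademacher sum in `ℓ²`,
  whose exponential moments follow from
  `cosh ‖x + y‖ + cosh ‖x - y‖ ≤ 2 cosh ‖x‖ cosh ‖y‖` in Hilbert spaces.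
* Linear maps (SSMs, weight matrices, pooling, decoder) act on the Rademacher sum itself, so that only
  their gain between supremum norms enters; for SSMs this is the `ℓ₁` norm. This makes the constants
  independent of the length of the sequences and of the widths of the networks.
* Lipschitz functions obey the Ledoux–Talagrand contraction principle (`RadBound.contraction`). Its
  inductive step is that `e^u + e^v ≤ e^P + e^Q` if `u, v ≤ max P Q` and `u + v ≤ P + Q`. Products in
  gated linear units reduce to squares by polarization, where Lipschitz bounds need the a priori
  bounds that are carried along in `VecBound` and `SeqBound`.

The suprema are replaced by upper bounds throughout, so the classes may be infinite. Symmetrization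
(`lintegral_iSup_exp_le`) transfers the exponential moments to the uniform deviation of empirical and
true losses, and Markov's inequality gives the tail bound directly, without a bounded difference
inequality. Measurability needs a countable class; since the models are continuous functions of the
input and the compact-open topology is second countable, a countable subclass is dense for pointwise
convergence, and a uniform deviation bound passes to limits by dominated convergence. An empirical
risk minimizer then loses at most twice the uniform deviation.
-/

namespace DeepSSM

/-! ### Rademacher sums -/

/-- The sign `±1` encoded by a Boolean. -/
def sgn (b : Bool) : ℝ := if b then 1 else -1

/-- The Rademacher sum `∑ i, ± a i`. The signs range over `Fin N → Bool` with the counting measure,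
so that expectations over the signs are finite sums divided by `2 ^ N`. -/
def signSum {N : ℕ} {E : Type*} [AddCommGroup E] [Module ℝ E] (s : Fin N → Bool)
    (a : Fin N → E) : E :=
  ∑ i, sgn (s i) • a i

section signSum

variable {N : ℕ} {E F : Type*} [AddCommGroup E] [Module ℝ E] [AddCommGroup F] [Module ℝ F]

lemma map_signSum (f : E →ₗ[ℝ] F) (s : Fin N → Bool) (a : Fin N → E) :
    f (signSum s a) = signSum s (fun i => f (a i)) := by
  simp [signSum]

lemma signSum_add (s : Fin N → Bool) (a b : Fin N → E) :
    signSum s (fun i => a i + b i) = signSum s a + signSum s b := by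
  simp [signSum, Finset.sum_add_distrib]

lemma signSum_sub (s : Fin N → Bool) (a b : Fin N → E) :
    signSum s (fun i => a i - b i) = signSum s a - signSum s b := by
  simp [signSum, smul_sub]

lemma signSum_smul (s : Fin N → Bool) (c : ℝ) (a : Fin N → E) :
    signSum s (fun i => c • a i) = c • signSum s a := by
  simp only [signSum, Finset.smul_sum]
  exact Finset.sum_congr rfl fun i _ => smul_comm _ _ _

lemma signSum_mul_left (s : Fin N → Bool) (c : ℝ) (a : Fin N → ℝ) :
    signSum s (fun i => c * a i) = c * signSum s a :=
  signSum_smul s c a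

lemma signSum_apply {J : Type*} (s : Fin N → Bool) (a : Fin N → J → E) (j : J) :
    signSum s a j = signSum s (fun i => a i j) := by
  simp [signSum]

lemma signSum_not (s : Fin N → Bool) (a : Fin N → E) :
    signSum (fun i => !s i) a = - signSum s a := by
  simp only [signSum, ← Finset.sum_neg_distrib, ← neg_smul]
  refine Finset.sum_congr rfl fun i _ => ?_
  cases s i <;> simp [sgn]

lemma signSum_cons (e : Bool) (s : Fin N → Bool) (a : Fin (N + 1) → E) :
    signSum (Fin.cons e s : Fin (N + 1) → Bool) a =
      sgn e • a 0 + signSum s (fun i => a i.succ) := by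
  simp [signSum, Fin.sum_univ_succ]

end signSum

lemma sum_signs_succ {N : ℕ} (f : (Fin (N + 1) → Bool) → ℝ) :
    ∑ s, f s = ∑ s : Fin N → Bool, (f (Fin.cons true s) + f (Fin.cons false s)) := by
  rw [← (Fin.consEquiv fun _ : Fin (N + 1) => Bool).sum_comp, Fintype.sum_prod_type,
    Fintype.sum_bool, ← Finset.sum_add_distrib]
  rfl

/-! ### Contraction -/

lemma exp_add_exp_le {u v P Q : ℝ} (hu : u ≤ max P Q) (hv : v ≤ max P Q) (huv : u + v ≤ P + Q) :
    Real.exp u + Real.exp v ≤ Real.exp P + Real.exp Q := by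
  wlog hPQ : Q ≤ P generalizing P Q
  · have := this (P := Q) (Q := P) (by rwa [max_comm]) (by rwa [max_comm]) (by linarith)
      (le_of_not_ge hPQ)
    linarith
  rw [max_eq_left hPQ] at hu hv
  rcases le_or_gt u Q with h | h
  · linarith [Real.exp_le_exp.2 h, Real.exp_le_exp.2 hv]
  · have h1 : Real.exp v ≤ Real.exp (P + Q - u) := Real.exp_le_exp.2 (by linarith)
    have h2 : Real.exp (P + Q - u) * Real.exp u = Real.exp P * Real.exp Q := by
      rw [← Real.exp_add, ← Real.exp_add]; ring_nf
    have h3 := Real.exp_le_exp.2 hu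
    have h4 := Real.exp_le_exp.2 h.le
    have h5 := Real.exp_pos u
    have h6 : (Real.exp P + Real.exp Q - Real.exp u - Real.exp (P + Q - u)) * Real.exp u ≥ 0 := by
      nlinarith [mul_nonneg (sub_nonneg.2 h3) (sub_nonneg.2 h4)]
    have := nonneg_of_mul_nonneg_left h6 h5
    linarith

/-- The step of the contraction principle that replaces a single coordinate `x` of the class by
`y`. -/
lemma exists_contraction_step {τ : Type*} (c x y : τ → ℝ) (hy : ∀ t, |y t| ≤ |x t|)
    (hd : ∀ t t', |y t - y t'| ≤ |x t - x t'|) {P Q : ℝ}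
    (hP : ∀ t, Real.exp (c t + x t) ≤ P) (hQ : ∀ t, Real.exp (c t - x t) ≤ Q) :
    ∃ P' Q' : ℝ, (∀ t, Real.exp (c t + y t) ≤ P') ∧ (∀ t, Real.exp (c t - y t) ≤ Q') ∧
      P' + Q' ≤ P + Q := by
  have key : ∀ t t', Real.exp (c t + y t) + Real.exp (c t' - y t') ≤ P + Q := by
    intro t t'
    have hP0 : 0 < P := (Real.exp_pos _).trans_le (hP t)
    have hQ0 : 0 < Q := (Real.exp_pos _).trans_le (hQ t)
    have lP : ∀ t, c t + x t ≤ Real.log P := fun t => (Real.le_log_iff_exp_le hP0).2 (hP t)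
    have lQ : ∀ t, c t - x t ≤ Real.log Q := fun t => (Real.le_log_iff_exp_le hQ0).2 (hQ t)
    have hmax : ∀ t, c t + |x t| ≤ max (Real.log P) (Real.log Q) := by
      intro t
      rcases abs_cases (x t) with h | h
      · exact le_max_of_le_left (by linarith [lP t])
      · exact le_max_of_le_right (by linarith [lQ t])
    have := exp_add_exp_le (u := c t + y t) (v := c t' - y t') (P := Real.log P) (Q := Real.log Q)
      (by linarith [hmax t, hy t, le_abs_self (y t)])
      (by linarith [hmax t', hy t', neg_abs_le (y t')])
      (by
        have h1 := hd t t'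
        have h2 := le_abs_self (y t - y t')
        rcases abs_cases (x t - x t') with h | h
        · linarith [lP t, lQ t']
        · linarith [lP t', lQ t])
    rwa [Real.exp_log hP0, Real.exp_log hQ0] at this
  have hbdd : BddAbove (Set.range fun t => Real.exp (c t + y t)) :=
    ⟨P + Q, by rintro _ ⟨t, rfl⟩; linarith [key t t, Real.exp_pos (c t - y t)]⟩
  refine ⟨⨆ t, Real.exp (c t + y t), P + Q - ⨆ t, Real.exp (c t + y t), fun t => le_ciSup hbdd t,
    fun t => ?_, by linarith⟩
  have : Nonempty τ := ⟨t⟩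
  have : (⨆ t, Real.exp (c t + y t)) ≤ P + Q - Real.exp (c t - y t) :=
    ciSup_le fun t' => by linarith [key t' t]
  linarith

/-- The contraction principle of Ledoux and Talagrand for exponential moments. The suprema over the
class are represented by arbitrary upper bounds `w` and `w'`, and the offset `c` makes an induction
over the coordinates possible. -/
lemma exists_contraction {τ : Type*} : ∀ {N : ℕ} (c : τ → ℝ) (a b : τ → Fin N → ℝ)
    (_ : ∀ t i, |b t i| ≤ |a t i|) (_ : ∀ t t' i, |b t i - b t' i| ≤ |a t i - a t' i|)
    (w : (Fin N → Bool) → ℝ) (_ : ∀ t s, Real.exp (c t + signSum s (a t)) ≤ w s),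
    ∃ w' : (Fin N → Bool) → ℝ, (∀ t s, Real.exp (c t + signSum s (b t)) ≤ w' s) ∧
      ∑ s, w' s ≤ ∑ s, w s := by
  intro N
  induction N with
  | zero =>
    intro c a b _ _ w hw
    exact ⟨w, fun t s => by simpa [signSum] using hw t s, le_rfl⟩
  | succ N ih =>
    intro c a b hb hd w hw
    have step : ∀ s : Fin N → Bool, ∃ P Q : ℝ,
        (∀ t, Real.exp (c t + b t 0 + signSum s (fun i => a t i.succ)) ≤ P) ∧
        (∀ t, Real.exp (c t - b t 0 + signSum s (fun i => a t i.succ)) ≤ Q) ∧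
        P + Q ≤ w (Fin.cons true s) + w (Fin.cons false s) := by
      intro s
      obtain ⟨P, Q, hP, hQ, hPQ⟩ := exists_contraction_step
        (fun t => c t + signSum s (fun i => a t i.succ)) (fun t => a t 0) (fun t => b t 0)
        (fun t => hb t 0) (fun t t' => hd t t' 0)
        (P := w (Fin.cons true s)) (Q := w (Fin.cons false s))
        (fun t => by
          refine le_trans (le_of_eq ?_) (hw t _)
          rw [signSum_cons]; simp [sgn]; ring)
        (fun t => by
          refine le_trans (le_of_eq ?_) (hw t _)
          rw [signSum_cons]; simp [sgn]; ring)
      refine ⟨P, Q, fun t => ?_, fun t => ?_, hPQ⟩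
      · convert hP t using 2; ring
      · convert hQ t using 2; ring
    choose P Q hP hQ hPQ using step
    obtain ⟨w₁, h₁, h₁'⟩ := ih (fun t => c t + b t 0) (fun t i => a t i.succ)
      (fun t i => b t i.succ) (fun t i => hb t _) (fun t t' i => hd t t' _) P (fun t s => hP s t)
    obtain ⟨w₂, h₂, h₂'⟩ := ih (fun t => c t - b t 0) (fun t i => a t i.succ)
      (fun t i => b t i.succ) (fun t i => hb t _) (fun t t' i => hd t t' _) Q (fun t s => hQ s t)
    refine ⟨fun s => if s 0 then w₁ (Fin.tail s) else w₂ (Fin.tail s), fun t s => ?_, ?_⟩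
    · rw [← Fin.cons_self_tail s, signSum_cons]
      cases s 0
      · simpa [sgn, sub_eq_add_neg, add_assoc] using h₂ t (Fin.tail s)
      · simpa [sgn, add_assoc] using h₁ t (Fin.tail s)
    · rw [sum_signs_succ, sum_signs_succ]
      simp only [Fin.cons_zero, Fin.tail_cons, if_true, Bool.false_eq_true, if_false]
      rw [Finset.sum_add_distrib]
      refine (add_le_add h₁' h₂').trans ?_
      rw [← Finset.sum_add_distrib]
      exact Finset.sum_le_sum fun s _ => hPQ s

/-! ### Classes with sub-Gaussian Rademacher suprema -/

/-- The class of vectors `a t ∈ ℝᴺ` has Rademacher suprema `sup_t |∑ i, ± a t i|` whose exponential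
moments are at most `C exp (N (l r)²)`. The supremum is represented by an upper bound `m`, so that
the index set may be infinite or empty. -/
def RadBound {N : ℕ} {τ : Type*} (C r : ℝ) (a : τ → Fin N → ℝ) : Prop :=
  ∃ m : (Fin N → Bool) → ℝ, (∀ s, 0 ≤ m s) ∧ (∀ t s, |signSum s (a t)| ≤ m s) ∧
    ∀ l : ℝ, 0 ≤ l → ∑ s, Real.exp (l * m s) ≤ 2 ^ N * (C * Real.exp (N * (l * r) ^ 2))

namespace RadBound

variable {N : ℕ} {τ τ' κ : Type*} {C C' r r' : ℝ} {a : τ → Fin N → ℝ} {b : τ' → Fin N → ℝ}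

lemma one_le (h : RadBound C r a) : 1 ≤ C := by
  obtain ⟨m, -, -, h⟩ := h
  have := h 0 le_rfl
  simp only [zero_mul, Real.exp_zero, Finset.sum_const, Finset.card_univ, Fintype.card_fun,
    Fintype.card_bool, Fintype.card_fin, nsmul_eq_mul, mul_one, ne_eq, OfNat.ofNat_ne_zero,
    not_false_eq_true, zero_pow, mul_zero] at this
  push_cast at this
  exact (le_mul_iff_one_le_right (by positivity)).1 this

lemma mono (h : RadBound C r a) (hC : C ≤ C') (hr : |r| ≤ |r'|) : RadBound C' r' a := by
  have h1 := h.one_le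
  obtain ⟨m, h0, hm, h⟩ := h
  refine ⟨m, h0, hm, fun l hl => (h l hl).trans ?_⟩
  have : (l * r) ^ 2 ≤ (l * r') ^ 2 := by
    rw [mul_pow, mul_pow]
    exact mul_le_mul_of_nonneg_left (sq_le_sq.2 hr) (sq_nonneg _)
  have hC' : 0 ≤ C' := by linarith
  gcongr

/-- The images of a class under maps that enlarge the Rademacher suprema at most by the factor
`K`. -/
lemma dominate (h : RadBound C r a) {K : ℝ} (hK : 0 ≤ K) {c : κ → Fin N → ℝ}
    (hc : ∀ s R, 0 ≤ R → (∀ t, |signSum s (a t)| ≤ R) → ∀ k, |signSum s (c k)| ≤ K * R) :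
    RadBound C (K * r) c := by
  obtain ⟨m, h0, hm, h⟩ := h
  refine ⟨fun s => K * m s, fun s => mul_nonneg hK (h0 s),
    fun k s => hc s (m s) (h0 s) (fun t => hm t s) k, fun l hl => ?_⟩
  have := h (l * K) (mul_nonneg hl hK)
  simpa only [mul_assoc] using this

/-- The version of `RadBound.dominate` for sums of two classes. -/
lemma dominate₂ (h : RadBound C r a) (h' : RadBound C' r' b) {c : κ → Fin N → ℝ}
    (hc : ∀ s R R', 0 ≤ R → 0 ≤ R' → (∀ t, |signSum s (a t)| ≤ R) →
      (∀ t, |signSum s (b t)| ≤ R') → ∀ k, |signSum s (c k)| ≤ R + R') :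
    RadBound (C + C') (2 * (|r| + |r'|)) c := by
  have h1 := h.one_le
  have h1' := h'.one_le
  have hr : |r| ≤ |(|r| + |r'|)| := by
    rw [abs_of_nonneg (by positivity : 0 ≤ |r| + |r'|)]; linarith [abs_nonneg r']
  have hr' : |r'| ≤ |(|r| + |r'|)| := by
    rw [abs_of_nonneg (by positivity : 0 ≤ |r| + |r'|)]; linarith [abs_nonneg r]
  obtain ⟨m, h0, hm, h⟩ := h.mono (C' := C + C') (by linarith) hr
  obtain ⟨m', h0', hm', h'⟩ := h'.mono (C' := C + C') (by linarith) hr'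
  refine ⟨fun s => m s + m' s, fun s => add_nonneg (h0 s) (h0' s),
    fun k s => hc s _ _ (h0 s) (h0' s) (fun t => hm t s) (fun t => hm' t s) k, fun l hl => ?_⟩
  have e1 := h (l * 2) (by positivity)
  have e2 := h' (l * 2) (by positivity)
  have e3 : ∀ s, Real.exp (l * (m s + m' s)) ≤
      (Real.exp (l * 2 * m s) + Real.exp (l * 2 * m' s)) / 2 := by
    intro s
    have hp : l * (m s + m' s) = l * m s + l * m' s := by ring
    have hq : l * 2 * m s = l * m s + l * m s := by ring
    have hq' : l * 2 * m' s = l * m' s + l * m' s := by ring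
    rw [hp, hq, hq', Real.exp_add, Real.exp_add, Real.exp_add]
    nlinarith [sq_nonneg (Real.exp (l * m s) - Real.exp (l * m' s))]
  refine (Finset.sum_le_sum fun s _ => e3 s).trans ?_
  rw [← Finset.sum_div, Finset.sum_add_distrib]
  rw [mul_assoc l 2] at e1 e2
  linarith

lemma contraction (h : RadBound C r a) {c : τ → Fin N → ℝ}
    (hc : ∀ t i, |c t i| ≤ |a t i|) (hd : ∀ t t' i, |c t i - c t' i| ≤ |a t i - a t' i|) :
    RadBound (2 * C) r c := by
  have h1 := h.one_le
  obtain ⟨m, h0, hm, h⟩ := h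
  rcases isEmpty_or_nonempty τ with hτ | hτ
  · refine ⟨fun _ => 0, fun _ => le_rfl, fun t => hτ.elim t, fun l hl => ?_⟩
    simp only [mul_zero, Real.exp_zero, Finset.sum_const, Finset.card_univ, Fintype.card_fun,
      Fintype.card_bool, Fintype.card_fin, nsmul_eq_mul, mul_one]
    push_cast
    have : (1 : ℝ) ≤ Real.exp (N * (l * r) ^ 2) := Real.one_le_exp (by positivity)
    exact le_mul_of_one_le_right (by positivity) (by nlinarith)
  have hbdd : ∀ s, BddAbove (Set.range fun t => |signSum s (c t)|) := by
    intro s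
    obtain ⟨w, hw, -⟩ := exists_contraction (fun _ => 0) a c hc hd (fun s => Real.exp (m s))
      (fun t s => by
        rw [zero_add]; exact Real.exp_le_exp.2 ((le_abs_self _).trans (hm t s)))
    refine ⟨max (w s) (w fun i => !s i), ?_⟩
    rintro _ ⟨t, rfl⟩
    have e1 := hw t s
    have e2 := hw t fun i => !s i
    rw [signSum_not, zero_add] at e2
    rw [zero_add] at e1
    refine abs_le'.2 ⟨le_max_of_le_left ?_, le_max_of_le_right ?_⟩
    · linarith [Real.add_one_le_exp (signSum s (c t))]
    · linarith [Real.add_one_le_exp (-signSum s (c t))]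
  refine ⟨fun s => ⨆ t, |signSum s (c t)|, fun s => Real.iSup_nonneg fun t => abs_nonneg _,
    fun t s => le_ciSup (hbdd s) t, fun l hl => ?_⟩
  rcases hl.eq_or_lt with rfl | hl
  · simp only [zero_mul, Real.exp_zero, Finset.sum_const, Finset.card_univ, Fintype.card_fun,
      Fintype.card_bool, Fintype.card_fin, nsmul_eq_mul, mul_one, ne_eq, OfNat.ofNat_ne_zero,
      not_false_eq_true, zero_pow, mul_zero]
    push_cast
    exact le_mul_of_one_le_right (by positivity) (by linarith)
  obtain ⟨w, hw, hs⟩ := exists_contraction (fun _ => 0) (fun t i => l * a t i)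
    (fun t i => l * c t i)
    (fun t i => by rw [abs_mul, abs_mul]; exact mul_le_mul_of_nonneg_left (hc t i) (abs_nonneg l))
    (fun t t' i => by
      rw [← mul_sub, ← mul_sub, abs_mul, abs_mul]
      exact mul_le_mul_of_nonneg_left (hd t t' i) (abs_nonneg l))
    (fun s => Real.exp (l * m s))
    (fun t s => by
      rw [zero_add, signSum_mul_left]
      exact Real.exp_le_exp.2 (mul_le_mul_of_nonneg_left ((le_abs_self _).trans (hm t s)) hl.le))
  simp only [zero_add, signSum_mul_left] at hw
  have hw0 : ∀ s, 0 < w s := fun s => (Real.exp_pos _).trans_le (hw hτ.some s)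
  have hle : ∀ s, Real.exp (l * ⨆ t, |signSum s (c t)|) ≤ w s + w (fun i => !s i) := by
    intro s
    have hW : 0 < w s + w (fun i => !s i) := add_pos (hw0 _) (hw0 _)
    rw [← Real.le_log_iff_exp_le hW, mul_comm, ← le_div_iff₀ hl]
    refine ciSup_le fun t => ?_
    rw [le_div_iff₀ hl, mul_comm, Real.le_log_iff_exp_le hW]
    rcases abs_cases (signSum s (c t)) with e | e
    · rw [e.1]; linarith [hw t s, hw0 fun i => !s i]
    · rw [e.1, ← signSum_not]; linarith [hw t fun i => !s i, hw0 s]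
  have hflip : ∑ s : Fin N → Bool, w (fun i => !s i) = ∑ s, w s :=
    (Equiv.piCongrRight fun _ : Fin N => Equiv.boolNot).sum_comp w
  calc _ ≤ ∑ s, (w s + w (fun i => !s i)) := Finset.sum_le_sum fun s _ => hle s
    _ ≤ 2 * ∑ s, Real.exp (l * m s) := by rw [Finset.sum_add_distrib, hflip]; linarith
    _ ≤ 2 * (2 ^ N * (C * Real.exp (N * (l * r) ^ 2))) := by linarith [h l hl.le]
    _ = _ := by ring

/-- The contraction principle with a Lipschitz constant. -/
lemma contraction_mul (h : RadBound C r a) {K : ℝ} (hK : 0 ≤ K) {c : τ → Fin N → ℝ}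
    (hc : ∀ t i, |c t i| ≤ K * |a t i|)
    (hd : ∀ t t' i, |c t i - c t' i| ≤ K * |a t i - a t' i|) :
    RadBound (2 * C) (K * r) c := by
  refine (h.dominate hK (c := fun t i => K * a t i) fun s R hR ht t => ?_).contraction
    (fun t i => ?_) (fun t t' i => ?_)
  · rw [signSum_mul_left, abs_mul, abs_of_nonneg hK]
    exact mul_le_mul_of_nonneg_left (ht t) hK
  · rw [abs_mul, abs_of_nonneg hK]; exact hc t i
  · rw [← mul_sub, abs_mul, abs_of_nonneg hK]; exact hd t t' i

end RadBound

/-! ### Rademacher sums in Hilbert spaces -/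

lemma pow_add_pow_le {x y X Y : ℝ} (hY : 0 ≤ Y) (hx : Y ≤ x) (hxX : x ≤ X) (h : x + y = X + Y)
    (k : ℕ) : x ^ k + y ^ k ≤ X ^ k + Y ^ k := by
  rcases (hx.trans hxX).eq_or_lt with e | e
  · have : x = X := by linarith
    have : y = Y := by linarith
    subst x y; rfl
  have hXY : 0 < X - Y := by linarith
  have hc := (convexOn_pow (𝕜 := ℝ) k).2
  set θ := (x - Y) / (X - Y) with hθ
  have h0 : 0 ≤ θ := div_nonneg (by linarith) hXY.le
  have h1 : 0 ≤ 1 - θ := by rw [sub_nonneg, hθ, div_le_one hXY]; linarith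
  have hθ' : θ * (X - Y) = x - Y := div_mul_cancel₀ _ hXY.ne'
  have e1 := hc (x := X) (y := Y) (by simp; linarith) (by simpa using hY) h0 h1 (by ring)
  have e2 := hc (x := X) (y := Y) (by simp; linarith) (by simpa using hY) h1 h0 (by ring)
  simp only [smul_eq_mul] at e1 e2
  rw [show θ * X + (1 - θ) * Y = x by linarith] at e1
  rw [show (1 - θ) * X + θ * Y = y by linarith] at e2
  linarith

section Hilbert

variable {E : Type*} [NormedAddCommGroup E] [InnerProductSpace ℝ E]

/-- Among all vectors of given norms, collinear ones maximize the left-hand side, because `cosh √z`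
has a power series with nonnegative coefficients. -/
lemma cosh_norm_add_add_cosh_norm_sub_le (x y : E) :
    Real.cosh ‖x + y‖ + Real.cosh ‖x - y‖ ≤ 2 * (Real.cosh ‖x‖ * Real.cosh ‖y‖) := by
  have h2 : 2 * (Real.cosh ‖x‖ * Real.cosh ‖y‖) =
      Real.cosh (‖x‖ + ‖y‖) + Real.cosh (‖x‖ - ‖y‖) := by
    rw [Real.cosh_add, Real.cosh_sub]; ring
  rw [h2]
  refine hasSum_le (fun k => ?_) ((Real.hasSum_cosh ‖x + y‖).add (Real.hasSum_cosh ‖x - y‖))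
    ((Real.hasSum_cosh (‖x‖ + ‖y‖)).add (Real.hasSum_cosh (‖x‖ - ‖y‖)))
  rw [← add_div, ← add_div]
  refine div_le_div_of_nonneg_right ?_ (by positivity)
  simp only [pow_mul]
  refine pow_add_pow_le (sq_nonneg _) ?_ ?_ ?_ k
  · rw [sq_le_sq, abs_norm]
    simpa using abs_norm_sub_norm_le x (-y)
  · exact pow_le_pow_left₀ (norm_nonneg _) (norm_add_le x y) 2
  · have := parallelogram_law_with_norm ℝ x y
    nlinarith

lemma sum_cosh_norm_signSum_le : ∀ {N : ℕ} (x : E) (u : Fin N → E),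
    ∑ s : Fin N → Bool, Real.cosh ‖x + signSum s u‖ ≤
      2 ^ N * (Real.cosh ‖x‖ * ∏ i, Real.cosh ‖u i‖) := by
  intro N
  induction N with
  | zero => intro x u; simp [signSum]
  | succ N ih =>
    intro x u
    rw [sum_signs_succ, Finset.sum_add_distrib]
    simp only [signSum_cons, ← add_assoc]
    refine (add_le_add (ih _ _) (ih _ _)).trans ?_
    have := cosh_norm_add_add_cosh_norm_sub_le x (u 0)
    simp only [sgn, if_true, one_smul, Bool.false_eq_true, if_false, neg_smul, ← sub_eq_add_neg]
    rw [← mul_add, ← add_mul, Fin.prod_univ_succ, pow_succ]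
    have hp : 0 ≤ ∏ i : Fin N, Real.cosh ‖u i.succ‖ :=
      Finset.prod_nonneg fun i _ => (Real.cosh_pos _).le
    calc _ ≤ 2 ^ N * (2 * (Real.cosh ‖x‖ * Real.cosh ‖u 0‖) *
          ∏ i : Fin N, Real.cosh ‖u i.succ‖) := by gcongr
      _ = _ := by ring

/-- The Rademacher sums of `N` vectors of norm at most `K` in a Hilbert space. -/
lemma RadBound.of_norm_signSum_le {N : ℕ} {τ : Type*} {a : τ → Fin N → ℝ} {K : ℝ} (u : Fin N → E)
    (hu : ∀ i, ‖u i‖ ≤ K) (ha : ∀ t s, |signSum s (a t)| ≤ ‖signSum s u‖) : RadBound 2 K a := by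
  refine ⟨fun s => ‖signSum s u‖, fun s => norm_nonneg _, ha, fun l hl => ?_⟩
  have h1 : ∀ s, Real.exp (l * ‖signSum s u‖) ≤
      2 * Real.cosh ‖0 + signSum s (fun i => l • u i)‖ := by
    intro s
    rw [zero_add, signSum_smul, norm_smul, Real.norm_of_nonneg hl, Real.cosh_eq]
    linarith [Real.exp_pos (-(l * ‖signSum s u‖))]
  have h2 : ∏ i, Real.cosh ‖l • u i‖ ≤ Real.exp (N * (l * K) ^ 2) := by
    have : ∀ i, Real.cosh ‖l • u i‖ ≤ Real.exp ((l * K) ^ 2) := by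
      intro i
      refine (Real.cosh_le_exp_half_sq _).trans (Real.exp_le_exp.2 ?_)
      rw [norm_smul, Real.norm_of_nonneg hl]
      have := pow_le_pow_left₀ (by positivity) (mul_le_mul_of_nonneg_left (hu i) hl) 2
      nlinarith [sq_nonneg (l * ‖u i‖)]
    refine (Finset.prod_le_prod (fun i _ => (Real.cosh_pos _).le) fun i _ => this i).trans ?_
    rw [Finset.prod_const, ← Real.exp_nat_mul, Finset.card_univ, Fintype.card_fin]
  calc _ ≤ ∑ s, 2 * Real.cosh ‖0 + signSum s (fun i => l • u i)‖ :=
        Finset.sum_le_sum fun s _ => h1 s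
    _ ≤ 2 * (2 ^ N * (Real.cosh ‖(0 : E)‖ * ∏ i, Real.cosh ‖l • u i‖)) := by
        rw [← Finset.mul_sum]
        exact mul_le_mul_of_nonneg_left (sum_cosh_norm_signSum_le _ _) zero_le_two
    _ ≤ 2 * (2 ^ N * Real.exp (N * (l * K) ^ 2)) := by
        rw [norm_zero, Real.cosh_zero, one_mul]; gcongr
    _ = _ := by ring

end Hilbert

/-- A single vector with bounded entries. -/
lemma RadBound.of_bounded {N : ℕ} {K : ℝ} (c : Fin N → ℝ) (hc : ∀ i, |c i| ≤ K) :
    RadBound 2 K (fun _ : Unit => c) :=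
  RadBound.of_norm_signSum_le c hc fun _ _ => le_rfl

/-! ### Symmetrization -/

section symmetrization

variable {X : Type*} [MeasurableSpace X] {N : ℕ} {τ : Type*}

/-- Exchanging a sample point with the corresponding point of an independent copy, at the positions
where `s` is `false`. -/
def swapSample (s : Fin N → Bool) (q : Fin N → X × X) : Fin N → X × X :=
  fun i => if s i then q i else (q i).swap

lemma measurePreserving_swapSample (D : Measure X) [IsProbabilityMeasure D] (s : Fin N → Bool) :
    MeasurePreserving (swapSample (X := X) s)
      (Measure.pi fun _ : Fin N => D.prod D) (Measure.pi fun _ : Fin N => D.prod D) := by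
  refine measurePreserving_pi (fun _ => D.prod D) (fun _ => D.prod D)
    (f := fun i (p : X × X) => if s i then p else p.swap) fun i => ?_
  cases s i
  · simpa using! Measure.measurePreserving_swap (μ := D) (ν := D)
  · simpa using! MeasurePreserving.id (D.prod D)

/-- Jensen's inequality for the passage from expectations to an independent copy of the sample. -/
lemma exp_abs_sum_sub_le (D : Measure X) [IsProbabilityMeasure D] {h : X → ℝ} (hm : Measurable h)
    {M : ℝ} (hM : ∀ x, |h x| ≤ M) {l : ℝ} (hl : 0 ≤ l) (S : Fin N → X) :
    ENNReal.ofReal (Real.exp (l * |∑ i, (h (S i) - ∫ x, h x ∂D)|)) ≤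
      ∫⁻ S', ENNReal.ofReal (Real.exp (l * |∑ i, (h (S i) - h (S' i))|))
        ∂Measure.pi (fun _ : Fin N => D) := by
  set μ := Measure.pi (fun _ : Fin N => D)
  have hmi : ∀ i : Fin N, Measurable fun S' : Fin N → X => h (S' i) :=
    fun i => hm.comp (measurable_pi_apply i)
  have hi : ∀ i : Fin N, Integrable (fun S' : Fin N → X => h (S' i)) μ := fun i =>
    Integrable.of_bound (hmi i).aestronglyMeasurable M (ae_of_all _ fun S' => hM _)
  have hmd : Measurable fun S' : Fin N → X => ∑ i, (h (S i) - h (S' i)) :=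
    Finset.measurable_sum _ fun i _ => (hmi i).const_sub _
  have hid : Integrable (fun S' : Fin N → X => ∑ i, (h (S i) - h (S' i))) μ :=
    integrable_finsetSum _ fun i _ => (integrable_const _).sub (hi i)
  have hint : ∑ i, (h (S i) - ∫ x, h x ∂D) = ∫ S', ∑ i, (h (S i) - h (S' i)) ∂μ := by
    rw [integral_finsetSum (f := fun (i : Fin N) (S' : Fin N → X) => h (S i) - h (S' i)) _
      fun i _ => (integrable_const _).sub (hi i)]
    refine Finset.sum_congr rfl fun i _ => ?_
    rw [integral_sub (integrable_const _) (hi i)]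
    simp only [integral_const, probReal_univ, smul_eq_mul, one_mul]
    rw [integral_comp_eval (μ := fun _ : Fin N => D) (i := i) hm.aestronglyMeasurable]
  have hbd : ∀ S' : Fin N → X, |∑ i, (h (S i) - h (S' i))| ≤ N * (2 * M) := by
    intro S'
    refine (Finset.abs_sum_le_sum_abs _ _).trans ?_
    refine (Finset.sum_le_card_nsmul _ _ (2 * M) fun i _ => ?_).trans (by simp)
    exact (abs_sub _ _).trans (by linarith [hM (S i), hM (S' i)])
  have hle : |∑ i, (h (S i) - ∫ x, h x ∂D)| ≤ ∫ S', |∑ i, (h (S i) - h (S' i))| ∂μ := by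
    rw [hint]; exact abs_integral_le_integral_abs
  have hexp : Integrable (fun S' => Real.exp (l * |∑ i, (h (S i) - h (S' i))|)) μ := by
    refine Integrable.of_bound (C := Real.exp (l * (N * (2 * M)))) ?_ (ae_of_all _ fun S' => ?_)
    · exact (Real.measurable_exp.comp (hmd.abs.const_mul l)).aestronglyMeasurable
    · simp only [Real.norm_eq_abs, Real.abs_exp]
      exact Real.exp_le_exp.2 (mul_le_mul_of_nonneg_left (hbd S') hl)
  rw [← ofReal_integral_eq_lintegral_ofReal hexp (ae_of_all _ fun S' => (Real.exp_pos _).le)]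
  refine ENNReal.ofReal_le_ofReal ?_
  refine (Real.exp_le_exp.2 (mul_le_mul_of_nonneg_left hle hl)).trans ?_
  rw [← integral_const_mul]
  exact convexOn_exp.map_integral_le Real.continuous_exp.continuousOn isClosed_univ
    (by simp) (hid.abs.const_mul l) hexp

/-- Symmetrization: the exponential moments of the supremum of a centered empirical process are
controlled by those of the Rademacher suprema. -/
lemma lintegral_iSup_exp_le [Countable τ] (D : Measure X) [IsProbabilityMeasure D] {h : τ → X → ℝ}
    (hm : ∀ t, Measurable (h t)) {M : ℝ} (hM : ∀ t x, |h t x| ≤ M) {C r : ℝ}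
    (hR : ∀ S : Fin N → X, RadBound C r fun t i => h t (S i)) {l : ℝ} (hl : 0 ≤ l) :
    ∫⁻ S, ⨆ t, ENNReal.ofReal (Real.exp (l * |∑ i, (h t (S i) - ∫ x, h t x ∂D)|))
        ∂Measure.pi (fun _ : Fin N => D) ≤
      ENNReal.ofReal (2 * C * Real.exp (N * (l * (4 * |r|)) ^ 2)) := by
  set μ := Measure.pi (fun _ : Fin N => D)
  set Ψ : (Fin N → X × X) → ℝ≥0∞ := fun q =>
    ⨆ t, ENNReal.ofReal (Real.exp (l * |∑ i, (h t (q i).1 - h t (q i).2)|)) with hΨ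
  have hΨm : Measurable Ψ := by
    refine Measurable.iSup fun t => ENNReal.measurable_ofReal.comp (Real.measurable_exp.comp ?_)
    refine Measurable.const_mul (Measurable.abs ?_) l
    refine Finset.measurable_sum _ fun i _ => Measurable.sub ?_ ?_
    · exact (hm t).comp (measurable_fst.comp (measurable_pi_apply i))
    · exact (hm t).comp (measurable_snd.comp (measurable_pi_apply i))
  -- pass to an independent copy of the sample
  have step1 : ∫⁻ S, ⨆ t, ENNReal.ofReal (Real.exp (l * |∑ i, (h t (S i) - ∫ x, h t x ∂D)|)) ∂μ ≤
      ∫⁻ S, ∫⁻ S', Ψ (fun i => (S i, S' i)) ∂μ ∂μ := by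
    refine lintegral_mono fun S => iSup_le fun t => ?_
    refine (exp_abs_sum_sub_le D (hm t) (hM t) hl S).trans ?_
    exact lintegral_mono fun S' => le_iSup (fun t => ENNReal.ofReal
      (Real.exp (l * |∑ i, (h t (S i) - h t (S' i))|))) t
  have step2 : ∫⁻ S, ∫⁻ S', Ψ (fun i => (S i, S' i)) ∂μ ∂μ =
      ∫⁻ q, Ψ q ∂Measure.pi (fun _ : Fin N => D.prod D) := by
    have e := measurePreserving_arrowProdEquivProdArrow X X (Fin N) (fun _ => D) (fun _ => D)
    have hΨ' : Measurable fun p : (Fin N → X) × (Fin N → X) => Ψ fun i => (p.1 i, p.2 i) :=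
      hΨm.comp (by fun_prop)
    rw [← lintegral_prod (fun p : (Fin N → X) × (Fin N → X) => Ψ fun i => (p.1 i, p.2 i))
      hΨ'.aemeasurable, ← e.lintegral_comp hΨ']
    rfl
  -- average over all exchanges of the two samples
  have step3 : ∫⁻ q, Ψ q ∂Measure.pi (fun _ : Fin N => D.prod D) =
      ∫⁻ q, (2 ^ N : ℝ≥0∞)⁻¹ * ∑ s : Fin N → Bool, Ψ (swapSample s q)
        ∂Measure.pi (fun _ : Fin N => D.prod D) := by
    have hs : ∀ s : Fin N → Bool, Measurable fun q : Fin N → X × X => Ψ (swapSample s q) :=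
      fun s => hΨm.comp (measurePreserving_swapSample D s).measurable
    rw [lintegral_const_mul _ (Finset.measurable_sum _ fun s _ => hs s),
      lintegral_finsetSum _ fun s _ => hs s]
    have : ∀ s : Fin N → Bool, ∫⁻ q, Ψ (swapSample s q) ∂Measure.pi (fun _ : Fin N => D.prod D) =
        ∫⁻ q, Ψ q ∂Measure.pi (fun _ : Fin N => D.prod D) :=
      fun s => (measurePreserving_swapSample D s).lintegral_comp hΨm
    simp only [this, Finset.sum_const, Finset.card_univ, Fintype.card_fun, Fintype.card_bool,
      Fintype.card_fin, nsmul_eq_mul]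
    push_cast
    rw [← mul_assoc, ENNReal.inv_mul_cancel (by simp) (by simp), one_mul]
  rw [step2, step3] at step1
  refine step1.trans ?_
  rw [← mul_one (ENNReal.ofReal _)]
  have hone : (1 : ℝ≥0∞) = Measure.pi (fun _ : Fin N => D.prod D) Set.univ := by simp
  rw [hone, ← lintegral_const]
  refine lintegral_mono fun q => ?_
  have hq : RadBound (2 * C) (4 * |r|) fun t i => h t (q i).1 - h t (q i).2 := by
    have := (hR fun i => (q i).1).dominate₂ (hR fun i => (q i).2)
      (c := fun t i => h t (q i).1 - h t (q i).2) fun s R R' _ _ h1 h2 t => by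
        rw [signSum_sub]; exact (abs_sub _ _).trans (add_le_add (h1 t) (h2 t))
    convert this using 1 <;> ring
  obtain ⟨m, h0, hm, hsum⟩ := hq
  have hle : ∀ s, Ψ (swapSample s q) ≤ ENNReal.ofReal (Real.exp (l * m s)) := by
    intro s
    refine iSup_le fun t => ENNReal.ofReal_le_ofReal (Real.exp_le_exp.2
      (mul_le_mul_of_nonneg_left ?_ hl))
    refine le_trans (le_of_eq ?_) (hm t s)
    rw [signSum]
    congr 1
    refine Finset.sum_congr rfl fun i _ => ?_
    cases hsi : s i <;> simp [swapSample, hsi, sgn]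
  refine (mul_le_mul_right (Finset.sum_le_sum fun s _ => hle s) _).trans ?_
  rw [← ENNReal.ofReal_sum_of_nonneg fun s _ => (Real.exp_pos _).le]
  refine (mul_le_mul_right (ENNReal.ofReal_le_ofReal (hsum l hl)) _).trans ?_
  rw [ENNReal.ofReal_mul (by positivity), ← mul_assoc,
    ENNReal.ofReal_pow zero_le_two, ENNReal.ofReal_ofNat,
    ENNReal.inv_mul_cancel (by simp) (by simp), one_mul]

/-- Uniform deviation bound for a countable class. -/
theorem measure_exists_deviation_le [Countable τ] (D : Measure X) [IsProbabilityMeasure D]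
    {h : τ → X → ℝ} (hm : ∀ t, Measurable (h t)) {M : ℝ} (hM : ∀ t x, |h t x| ≤ M) {C r : ℝ}
    (hC : 1 ≤ C) (hr : 0 < r) (hN : 0 < N)
    (hR : ∀ S : Fin N → X, RadBound C r fun t i => h t (S i)) {δ : ℝ} (hδ : 0 < δ) (hδ1 : δ < 1) :
    Measure.pi (fun _ : Fin N => D)
        {S | ∃ t, 8 * r * Real.sqrt (Real.log (2 * C / δ)) / Real.sqrt N <
          |(1 / (N : ℝ)) * ∑ i, h t (S i) - ∫ x, h t x ∂D|} ≤ ENNReal.ofReal δ := by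
  set μ := Measure.pi (fun _ : Fin N => D)
  have hN' : (0 : ℝ) < N := by exact_mod_cast hN
  set L := Real.log (2 * C / δ) with hLdef
  have hL : 0 < L := Real.log_pos (by rw [one_lt_div hδ]; linarith)
  -- the minimizer of the exponent `N (4 l r)² - 8 l r √(N L)`
  set l := Real.sqrt L / Real.sqrt N / (4 * r) with hldef
  have hl : 0 ≤ l := by positivity
  set Φ : (Fin N → X) → ℝ≥0∞ := fun S =>
    ⨆ t, ENNReal.ofReal (Real.exp (l * |∑ i, (h t (S i) - ∫ x, h t x ∂D)|))
  have hΦm : Measurable Φ := by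
    refine Measurable.iSup fun t => ENNReal.measurable_ofReal.comp (Real.measurable_exp.comp ?_)
    refine Measurable.const_mul (Measurable.abs ?_) l
    exact Finset.measurable_sum _ fun i _ => ((hm t).comp (measurable_pi_apply i)).sub_const _
  have hΦ := lintegral_iSup_exp_le (N := N) D hm hM hR hl
  have hsN : Real.sqrt N * Real.sqrt N = N := Real.mul_self_sqrt hN'.le
  have hsN0 : 0 < Real.sqrt N := Real.sqrt_pos.2 hN'
  have e1 : (N : ℝ) * (l * (4 * |r|)) ^ 2 = L := by
    rw [abs_of_pos hr, hldef, div_mul_cancel₀ _ (by positivity), div_pow, Real.sq_sqrt hL.le,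
      Real.sq_sqrt hN'.le]
    field_simp
  have e2 : 2 * C * Real.exp L = 4 * C ^ 2 / δ := by
    rw [hLdef, Real.exp_log (by positivity)]; ring
  have hsub : {S : Fin N → X | ∃ t, 8 * r * Real.sqrt L / Real.sqrt N <
      |(1 / (N : ℝ)) * ∑ i, h t (S i) - ∫ x, h t x ∂D|} ⊆
      {S | ENNReal.ofReal (Real.exp (2 * L)) ≤ Φ S} := by
    rintro S ⟨t, ht⟩
    refine le_trans (ENNReal.ofReal_le_ofReal (Real.exp_le_exp.2 ?_)) (le_iSup (fun t =>
      ENNReal.ofReal (Real.exp (l * |∑ i, (h t (S i) - ∫ x, h t x ∂D)|))) t)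
    have e3 : ∑ i, (h t (S i) - ∫ x, h t x ∂D) =
        N * ((1 / (N : ℝ)) * ∑ i, h t (S i) - ∫ x, h t x ∂D) := by
      rw [Finset.sum_sub_distrib]
      simp only [Finset.sum_const, Finset.card_univ, Fintype.card_fin, nsmul_eq_mul]
      field_simp
    rw [e3, abs_mul, abs_of_pos hN']
    calc 2 * L = l * (N * (8 * r * Real.sqrt L / Real.sqrt N)) := by
          rw [hldef]
          field_simp
          rw [Real.sq_sqrt hN'.le, Real.sq_sqrt hL.le]
          ring
      _ ≤ _ := by gcongr
  refine (measure_mono hsub).trans ?_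
  refine (meas_ge_le_lintegral_div hΦm.aemeasurable (by simp [Real.exp_pos])
    ENNReal.ofReal_ne_top).trans ?_
  refine (ENNReal.div_le_div_right hΦ _).trans ?_
  rw [e1, ← ENNReal.ofReal_div_of_pos (Real.exp_pos _)]
  refine ENNReal.ofReal_le_ofReal (le_of_eq ?_)
  rw [e2, two_mul L, Real.exp_add, hLdef, Real.exp_log (by positivity)]
  field_simp
  ring

end symmetrization

/-! ### Sums and products of classes -/

namespace RadBound

variable {N : ℕ} {τ κ : Type*} {C C' r r' B : ℝ} {a b : τ → Fin N → ℝ}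

lemma reindex (h : RadBound C r a) (g : κ → τ) : RadBound C r fun k => a (g k) := by
  simpa using h.dominate (K := 1) zero_le_one (c := fun k => a (g k))
    fun s R _ ht k => by simpa using ht (g k)

lemma add (h : RadBound C r a) (h' : RadBound C' r' b) :
    RadBound (C + C') (2 * (|r| + |r'|)) fun t i => a t i + b t i :=
  h.dominate₂ h' fun s R R' _ _ h1 h2 t => by
    rw [signSum_add]; exact (abs_add_le _ _).trans (add_le_add (h1 t) (h2 t))

lemma sub (h : RadBound C r a) (h' : RadBound C' r' b) :
    RadBound (C + C') (2 * (|r| + |r'|)) fun t i => a t i - b t i :=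
  h.dominate₂ h' fun s R R' _ _ h1 h2 t => by
    rw [signSum_sub]; exact (abs_sub _ _).trans (add_le_add (h1 t) (h2 t))

/-- Adding multiples of a fixed vector to the members of a class. -/
lemma add_const_mul (h : RadBound C r a) {c : Fin N → ℝ} {Kc : ℝ}
    (hc : RadBound C' r' fun _ : Unit => c) (β : τ → ℝ) (hβ : ∀ t, |β t| ≤ Kc) (hKc : 0 ≤ Kc) :
    RadBound (C + C') (2 * (|r| + |Kc * r'|)) fun t i => a t i + β t * c i :=
  h.add (hc.dominate hKc (c := fun t i => β t * c i) fun s R hR ht t => by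
    rw [signSum_mul_left, abs_mul]
    exact mul_le_mul (hβ t) (ht ()) (abs_nonneg _) hKc)

lemma mul_self (h : RadBound C r a) (hB : ∀ t i, |a t i| ≤ B) :
    RadBound (2 * C) (2 * |B| * r) fun t i => a t i * a t i := by
  refine h.contraction_mul (by positivity) (fun t i => ?_) (fun t t' i => ?_)
  · rw [abs_mul]
    refine mul_le_mul_of_nonneg_right ?_ (abs_nonneg _)
    linarith [hB t i, le_abs_self B, abs_nonneg B]
  · rw [mul_self_sub_mul_self, abs_mul]
    refine mul_le_mul_of_nonneg_right ?_ (abs_nonneg _)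
    linarith [abs_add_le (a t i) (a t' i), hB t i, hB t' i, le_abs_self B]

/-- Entrywise products of bounded classes, by the polarization identity
`4 x y = (x + y)² - (x - y)²` and contraction of the squares. -/
lemma mul (h : RadBound C r a) (h' : RadBound C' r' b) (ha : ∀ t i, |a t i| ≤ B)
    (hb : ∀ t i, |b t i| ≤ B) :
    RadBound (4 * (C + C')) (8 * (|B| * (|r| + |r'|))) fun t i => a t i * b t i := by
  have h1 := (h.add h').mul_self (B := B + B) fun t i =>
    (abs_add_le _ _).trans (add_le_add (ha t i) (hb t i))
  have h2 := (h.sub h').mul_self (B := B + B) fun t i =>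
    (abs_sub _ _).trans (add_le_add (ha t i) (hb t i))
  have h3 := (h1.sub h2).dominate (K := 1 / 4) (by norm_num) (c := fun t i => a t i * b t i)
    fun s R hR ht t => by
      have e : (fun i => a t i * b t i) = fun i => (1 / 4 : ℝ) *
          ((a t i + b t i) * (a t i + b t i) - (a t i - b t i) * (a t i - b t i)) := by
        funext i; ring
      rw [e, signSum_mul_left, abs_mul, abs_of_nonneg (by norm_num : (0 : ℝ) ≤ 1 / 4)]
      exact mul_le_mul_of_nonneg_left (ht t) (by norm_num)
  refine h3.mono (by linarith [h.one_le, h'.one_le]) (le_of_eq ?_)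
  rw [← two_mul B]
  simp only [abs_mul, abs_abs, abs_of_nonneg (add_nonneg (abs_nonneg r) (abs_nonneg r')),
    abs_of_nonneg (by norm_num : (0 : ℝ) ≤ 1 / 4), Nat.abs_ofNat]
  rw [abs_of_nonneg (by positivity)]
  ring

end RadBound

/-! ### Families of vectors and pointwise layers -/

/-- A family of `N`-tuples of vectors whose entries are at most `B` in absolute value, and whose
coordinates form a class satisfying `RadBound C r`. The dimension may vary within the family, since
the widths of the hidden layers vary with the network. -/
structure VecBound {N : ℕ} {κ : Type} {n : κ → ℕ} (C r B : ℝ) (Y : ∀ t, Fin N → Fin (n t) → ℝ) :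
    Prop where
  rad : RadBound C r fun (p : Σ t, Fin (n t)) i => Y p.1 i p.2
  bound : ∀ t i j, |Y t i j| ≤ B

lemma abs_mulVec_le {m n : ℕ} (W : Matrix (Fin n) (Fin m) ℝ) (x : Fin m → ℝ) {R : ℝ} (hR : 0 ≤ R)
    (hx : ∀ j, |x j| ≤ R) (j : Fin n) : |(W *ᵥ x) j| ≤ normInfInf W * R := by
  have h1 : ‖W *ᵥ x‖ ≤ normInfInf W * ‖x‖ := Matrix.linfty_opNorm_mulVec W x
  have h2 : ‖x‖ ≤ R := (pi_norm_le_iff_of_nonneg hR).2 hx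
  have h3 : 0 ≤ normInfInf W := by
    let _ : NormedAddCommGroup (Matrix (Fin n) (Fin m) ℝ) := Matrix.linftyOpNormedAddCommGroup
    exact norm_nonneg W
  exact (norm_le_pi_norm (W *ᵥ x) j).trans (h1.trans (mul_le_mul_of_nonneg_left h2 h3))

lemma signSum_mulVec {N m n : ℕ} (W : Matrix (Fin n) (Fin m) ℝ) (s : Fin N → Bool)
    (x : Fin N → Fin m → ℝ) (j : Fin n) :
    signSum s (fun i => (W *ᵥ x i) j) = (W *ᵥ signSum s x) j := by
  rw [← signSum_apply]
  exact congrFun (map_signSum W.mulVecLin s x).symm j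

lemma VecBound.affine {N : ℕ} {κ : Type} {m n : κ → ℕ} {C r B KW Kb : ℝ}
    {Y : ∀ t, Fin N → Fin (m t) → ℝ} (h : VecBound C r B Y)
    {W : ∀ t, Matrix (Fin (n t)) (Fin (m t)) ℝ} {b : ∀ t, Fin (n t) → ℝ}
    (hW : ∀ t, normInfInf (W t) < KW) (hb : ∀ t, ‖b t‖ < Kb) :
    VecBound (C + 2) (2 * (|(|KW| * r)| + |(|Kb| * 1)|)) (|KW| * |B| + |Kb|)
      fun t i => W t *ᵥ Y t i + b t := by
  have hW' : ∀ t, normInfInf (W t) ≤ |KW| := fun t => (hW t).le.trans (le_abs_self _)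
  have hb' : ∀ t j, |b t j| ≤ |Kb| := fun t j =>
    (norm_le_pi_norm (b t) j).trans ((hb t).le.trans (le_abs_self _))
  constructor
  · have h1 := h.rad.dominate (abs_nonneg KW)
      (c := fun (p : Σ t, Fin (n t)) i => (W p.1 *ᵥ Y p.1 i) p.2) fun s R hR ht p => by
        rw [signSum_mulVec]
        refine (abs_mulVec_le (W p.1) _ hR (fun l => ?_) p.2).trans
          (mul_le_mul_of_nonneg_right (hW' p.1) hR)
        rw [signSum_apply]
        exact ht ⟨p.1, l⟩
    have h2 := h1.add_const_mul (RadBound.of_bounded (N := N) (fun _ => 1) fun _ => abs_one.le)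
      (fun p => b p.1 p.2) (fun p => hb' p.1 p.2) (abs_nonneg Kb)
    simpa using h2
  · intro t i j
    refine (abs_add_le _ _).trans (add_le_add ?_ (hb' t j))
    exact (abs_mulVec_le (W t) _ (abs_nonneg B)
      (fun l => (h.bound t i l).trans (le_abs_self B)) j).trans
      (mul_le_mul_of_nonneg_right (hW' t) (abs_nonneg B))

/-- Entrywise application of a Lipschitz function that vanishes at `0`. -/
lemma VecBound.contraction {N : ℕ} {κ : Type} {n : κ → ℕ} {C r B K : ℝ}
    {Y : ∀ t, Fin N → Fin (n t) → ℝ} (h : VecBound C r B Y) (hK : 0 ≤ K) {ρ : ℝ → ℝ}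
    (h0 : ρ 0 = 0) (hρ : ∀ x y, |ρ x - ρ y| ≤ K * |x - y|) :
    VecBound (2 * C) (K * r) (K * B) fun t i j => ρ (Y t i j) := by
  have hb : ∀ x, |ρ x| ≤ K * |x| := fun x => by simpa [h0] using hρ x 0
  exact ⟨h.rad.contraction_mul hK (fun _ _ => hb _) (fun _ _ _ => hρ _ _),
    fun t i j => (hb _).trans (mul_le_mul_of_nonneg_left (h.bound t i j) hK)⟩

lemma VecBound.activation {N : ℕ} {κ : Type} {n : κ → ℕ} {C r B : ℝ}
    {Y : ∀ t, Fin N → Fin (n t) → ℝ} (h : VecBound C r B Y) {ρ : ℝ → ℝ} (h0 : |ρ 0| ≤ 1)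
    (hρ : LipschitzWith 1 ρ) :
    VecBound (2 * C + 2) (2 * (|r| + 1)) (B + 1) fun t i j => ρ (Y t i j) := by
  have h1 := h.contraction zero_le_one (ρ := fun x => ρ x - ρ 0) (sub_self _) fun x y => by
    simpa [Real.dist_eq] using hρ.dist_le_mul x y
  constructor
  · have h2 := h1.rad.add_const_mul
      (RadBound.of_bounded (N := N) (fun _ => 1) fun _ => abs_one.le)
      (fun _ => ρ 0) (fun _ => h0) zero_le_one
    simpa using h2
  · intro t i j
    have := h1.bound t i j
    simp only [one_mul] at this
    calc |ρ (Y t i j)| = |(ρ (Y t i j) - ρ 0) + ρ 0| := by ring_nf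
      _ ≤ B + 1 := (abs_add_le _ _).trans (add_le_add this h0)

/-- Networks of fixed depth with bounded weights, of arbitrary widths. -/
lemma exists_vecBound_mlp (KW Kb : ℝ) : ∀ (M : ℕ) (C r B : ℝ), ∃ C' r' B' : ℝ,
    ∀ (ρ : ℝ → ℝ), |ρ 0| ≤ 1 → LipschitzWith 1 ρ → ∀ (N : ℕ) (κ : Type) (m n : κ → ℕ)
      (w : ∀ t, MLPWeights M (m t) (n t)), (∀ t, (w t).Bounded KW Kb) →
      ∀ Y : ∀ t, Fin N → Fin (m t) → ℝ, VecBound C r B Y →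
        VecBound C' r' B' fun t i => (w t).eval ρ (Y t i) := by
  intro M
  induction M with
  | zero =>
    intro C r B
    refine ⟨C + 2, 2 * (|(|KW| * r)| + |(|Kb| * 1)|), |KW| * |B| + |Kb|,
      fun ρ _ _ N κ m n w hw Y hY => ?_⟩
    have : ∀ t, ∃ W b, w t = .output W b := fun t => by
      cases w t with
      | output W b => exact ⟨W, b, rfl⟩
    choose W b hWb using this
    have hw' : ∀ t, normInfInf (W t) < KW ∧ ‖b t‖ < Kb := fun t => by
      have := hw t
      rwa [hWb t] at this
    have := hY.affine (fun t => (hw' t).1) (fun t => (hw' t).2)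
    simpa only [hWb] using! this
  | succ M ih =>
    intro C r B
    obtain ⟨C', r', B', h⟩ := ih (2 * (C + 2) + 2)
      (2 * (|2 * (|(|KW| * r)| + |(|Kb| * 1)|)| + 1)) (|KW| * |B| + |Kb| + 1)
    refine ⟨C', r', B', fun ρ h0 hρ N κ m n w hw Y hY => ?_⟩
    have : ∀ t, ∃ (d : ℕ) (W : Matrix (Fin d) (Fin (m t)) ℝ) (b : Fin d → ℝ)
        (v : MLPWeights M d (n t)), w t = .hidden W b v := fun t => by
      cases w t with
      | hidden W b v => exact ⟨_, W, b, v, rfl⟩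
    choose d W b v hWb using this
    have hw' : ∀ t, normInfInf (W t) < KW ∧ ‖b t‖ < Kb ∧ (v t).Bounded KW Kb := fun t => by
      have := hw t
      rwa [hWb t] at this
    have := h ρ h0 hρ N κ d n v (fun t => (hw' t).2.2) _
      ((hY.affine (fun t => (hw' t).1) (fun t => (hw' t).2.1)).activation h0 hρ)
    simpa only [hWb] using! this

/-! ### The Gaussian error linear unit -/

lemma mul_gaussianPDFReal_le_one (t : ℝ) : |t| * gaussianPDFReal 0 1 t ≤ 1 := by
  have h1 : gaussianPDFReal 0 1 t ≤ Real.exp (-(t ^ 2 / 2)) := by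
    rw [gaussianPDFReal]
    simp only [NNReal.coe_one, mul_one, sub_zero, neg_div]
    refine mul_le_of_le_one_left (Real.exp_pos _).le (inv_le_one_of_one_le₀ ?_)
    rw [Real.one_le_sqrt]
    linarith [Real.pi_gt_three]
  have h2 : |t| ≤ Real.exp (t ^ 2 / 2) := by
    have := Real.add_one_le_exp (t ^ 2 / 2)
    nlinarith [sq_nonneg (|t| - 1), sq_abs t]
  calc |t| * gaussianPDFReal 0 1 t ≤ Real.exp (t ^ 2 / 2) * Real.exp (-(t ^ 2 / 2)) :=
        mul_le_mul h2 h1 (gaussianPDFReal_nonneg _ _ _) (Real.exp_pos _).le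
    _ = 1 := by rw [← Real.exp_add, add_neg_cancel, Real.exp_zero]

/-- The growth of the distribution function on an interval at distance `a` from the origin: the
density is at most `1 / a` there. -/
lemma mul_cdf_sub_cdf_le {a x y : ℝ} (ha : 0 ≤ a) (hxy : x ≤ y)
    (h : ∀ t ∈ Set.Ioc x y, a ≤ |t|) :
    a * (cdf (gaussianReal 0 1) y - cdf (gaussianReal 0 1) x) ≤ y - x := by
  rcases ha.eq_or_lt with rfl | ha
  · simpa using hxy
  have h1 : cdf (gaussianReal 0 1) y - cdf (gaussianReal 0 1) x =
      (gaussianReal 0 1).real (Set.Ioc x y) := by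
    rw [cdf_eq_real, cdf_eq_real, ← Set.Iic_sdiff_Iic,
      measureReal_sdiff (Set.Iic_subset_Iic.2 hxy) measurableSet_Iic]
  have h2 : gaussianReal 0 1 (Set.Ioc x y) ≤ ENNReal.ofReal ((y - x) / a) := by
    rw [gaussianReal_apply _ one_ne_zero]
    calc ∫⁻ t in Set.Ioc x y, gaussianPDF 0 1 t
        ≤ ∫⁻ _ in Set.Ioc x y, ENNReal.ofReal (1 / a) := by
          refine setLIntegral_mono measurable_const fun t ht => ENNReal.ofReal_le_ofReal ?_
          rw [le_div_iff₀ ha, mul_comm]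
          exact (mul_le_mul_of_nonneg_right (h t ht) (gaussianPDFReal_nonneg _ _ _)).trans
            (mul_gaussianPDFReal_le_one t)
      _ = ENNReal.ofReal ((y - x) / a) := by
          rw [setLIntegral_const, Real.volume_Ioc, ← ENNReal.ofReal_mul (by positivity)]
          ring_nf
  have h3 : (gaussianReal 0 1).real (Set.Ioc x y) ≤ (y - x) / a :=
    ENNReal.toReal_le_of_le_ofReal (div_nonneg (by linarith) ha.le) h2
  rw [h1]
  calc _ ≤ a * ((y - x) / a) := mul_le_mul_of_nonneg_left h3 ha.le
    _ = y - x := by field_simp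

lemma gelu_zero : gelu 0 = 0 := by simp [gelu]

lemma abs_gelu_sub_le (x y : ℝ) : |gelu x - gelu y| ≤ 2 * |x - y| := by
  wlog hxy : x ≤ y generalizing x y
  · rw [abs_sub_comm, abs_sub_comm x]
    exact this y x (le_of_not_ge hxy)
  -- both points on the same side of the origin
  have same : ∀ x y : ℝ, x ≤ y → (0 ≤ x ∨ y ≤ 0) → |gelu x - gelu y| ≤ 2 * (y - x) := by
    intro x y hxy h
    have hm : cdf (gaussianReal 0 1) x ≤ cdf (gaussianReal 0 1) y := monotone_cdf _ hxy
    have h0 := cdf_nonneg (gaussianReal 0 1) x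
    have h1 := cdf_le_one (gaussianReal 0 1) y
    simp only [gelu]
    generalize hp : cdf (gaussianReal 0 1) x = p at *
    generalize hq : cdf (gaussianReal 0 1) y = q at *
    rcases h with h | h
    · have := mul_cdf_sub_cdf_le h hxy fun t ht => ht.1.le.trans (le_abs_self t)
      rw [hp, hq] at this
      have e1 : x * p ≤ y * q := mul_le_mul hxy hm h0 (h.trans hxy)
      rw [abs_sub_comm, abs_of_nonneg (by linarith)]
      nlinarith
    · have := mul_cdf_sub_cdf_le (a := -y) (by linarith) hxy fun t ht => by
        rw [abs_of_nonpos (ht.2.trans h)]; linarith [ht.2]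
      rw [hp, hq] at this
      rw [abs_le]
      constructor <;> nlinarith [mul_nonneg (sub_nonneg.2 hxy) h0,
        mul_nonneg (neg_nonneg.2 h) (sub_nonneg.2 hm)]
  rw [abs_sub_comm x, abs_of_nonneg (sub_nonneg.2 hxy)]
  rcases le_total 0 x with hx | hx
  · exact same x y hxy (Or.inl hx)
  rcases le_total y 0 with hy | hy
  · exact same x y hxy (Or.inr hy)
  have e1 := same x 0 hx (Or.inr le_rfl)
  have e2 := same 0 y hy (Or.inl le_rfl)
  calc _ ≤ |gelu x - gelu 0| + |gelu 0 - gelu y| := abs_sub_le _ _ _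
    _ ≤ 2 * (y - x) := by linarith

/-! ### Nonlinear layers -/

lemma lipschitzWith_relu : LipschitzWith 1 relu :=
  LipschitzWith.of_dist_le_mul fun x y => by
    simpa [Real.dist_eq, relu] using abs_max_sub_max_le_abs x y 0

lemma IsSigmoid.abs_zero_le {ρ : ℝ → ℝ} (h : IsSigmoid ρ) : |ρ 0| ≤ 1 := by
  rw [h.zero]; norm_num

/-- A family of gated linear units. -/
lemma exists_vecBound_glu (KG C r B : ℝ) : ∃ C' r' B' : ℝ,
    ∀ (σ : ℝ → ℝ), IsSigmoid σ → ∀ (N : ℕ) (κ : Type) (ny nu : ℕ) (hd : κ → nu = ny)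
      (W : κ → Matrix (Fin nu) (Fin ny) ℝ), (∀ t, normInfInf (W t) < KG) →
      ∀ Y : κ → Fin N → Fin ny → ℝ, VecBound C r B Y →
        VecBound C' r' B' fun t i => (NonlinearLayer.glu σ (hd t) (W t)).eval (Y t i) := by
  set B₁ := |KG| * |2 * B| + |(1 : ℝ)| + 1 with hB₁
  have hB0 : 0 ≤ B₁ := by positivity
  refine ⟨4 * (2 * C + (2 * (2 * C + 2) + 2)), 8 * (|(|2 * B| + B₁)| *
    (|2 * r| + |2 * (|2 * (|(|KG| * (2 * r))| + |(|1| * 1)|)| + 1)|)),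
    (|2 * B| + B₁) * (|2 * B| + B₁), fun σ hσ N κ ny nu hd W hW Y hY => ?_⟩
  have hG := hY.contraction zero_le_two gelu_zero abs_gelu_sub_le
  have hV := (hG.affine (b := fun _ => 0) (Kb := 1) hW fun _ => by simp).activation
    hσ.abs_zero_le hσ.lipschitz
  simp only [add_zero] at hV
  have hGr := hG.rad.reindex fun p : (Σ _ : κ, Fin nu) => ⟨p.1, Fin.cast (hd p.1) p.2⟩
  have b1 : ∀ t i j, |gelu (Y t i j)| ≤ |2 * B| + B₁ := fun t i j =>
    (hG.bound t i j).trans (by linarith [le_abs_self (2 * B)])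
  have b2 : ∀ t i j, |σ ((W t *ᵥ fun l => gelu (Y t i l)) j)| ≤ |2 * B| + B₁ := fun t i j =>
    (hV.bound t i j).trans (by linarith [abs_nonneg (2 * B)])
  refine ⟨hGr.mul hV.rad (fun p i => b1 _ _ _) (fun p i => b2 _ _ _), fun t i j => ?_⟩
  simp only [NonlinearLayer.eval]
  rw [abs_mul]
  exact mul_le_mul (b1 t i (Fin.cast (hd t) j)) (b2 t i j) (abs_nonneg _) (by positivity)

lemma exists_vecBound_layer (K : LayerBounds) (C r B : ℝ) : ∃ C' r' B' : ℝ,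
    ∀ (ρ : ℝ → ℝ), K.Admissible ρ → ∀ (N : ℕ) (κ : Type) (ny nu : ℕ)
      (g : κ → NonlinearLayer ny nu), (∀ t, NonlinearLayer.Respects ρ K (g t)) →
      ∀ Y : κ → Fin N → Fin ny → ℝ, VecBound C r B Y →
        VecBound C' r' B' fun t i => (g t).eval (Y t i) := by
  cases K with
  | mlp M KW Kb =>
    obtain ⟨C', r', B', h⟩ := exists_vecBound_mlp KW Kb M C r B
    refine ⟨C', r', B', fun ρ hρ N κ ny nu g hg Y hY => ?_⟩
    have hg' : ∀ t, ∃ w : MLPWeights M ny nu, g t = .mlp ρ M w ∧ w.Bounded KW Kb := fun t => by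
      have := hg t
      revert this
      cases g t with
      | mlp ρ' M' w => rintro ⟨rfl, rfl, hw⟩; exact ⟨w, rfl, hw⟩
      | glu σ hd W => exact fun h => h.elim
    choose w hw hwb using hg'
    have hρ' : |ρ 0| ≤ 1 ∧ LipschitzWith 1 ρ := by
      rcases hρ.2 with rfl | hρ
      · exact ⟨by simp [relu], lipschitzWith_relu⟩
      · exact ⟨hρ.abs_zero_le, hρ.lipschitz⟩
    simpa only [hw] using! h ρ hρ'.1 hρ'.2 N κ _ _ w hwb Y hY
  | glu KG =>
    obtain ⟨C', r', B', h⟩ := exists_vecBound_glu KG C r B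
    refine ⟨C', r', B', fun ρ hρ N κ ny nu g hg Y hY => ?_⟩
    have hg' : ∀ t, ∃ (hd : nu = ny) (W : Matrix (Fin nu) (Fin ny) ℝ),
        g t = .glu ρ hd W ∧ normInfInf W < KG := fun t => by
      have := hg t
      revert this
      cases g t with
      | mlp ρ' M' w => exact fun h => h.elim
      | glu σ hd W => rintro ⟨rfl, hW⟩; exact ⟨hd, W, rfl, hW⟩
    choose hd W hW hWb using hg'
    simpa only [hW] using! h ρ hρ N κ ny nu hd W hWb Y hY

/-! ### State-space models -/

namespace SSM

variable {nu ny T : ℕ}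

/-- The impulse response formula. -/
lemma state_eq_sum (S : SSM nu ny) (u : Sequence T nu) (k : ℕ) :
    S.state u k = ∑ p ∈ Finset.range k,
      (S.A ^ p * S.B) *ᵥ (if h : k - 1 - p < T then u ⟨k - 1 - p, h⟩ else 0) := by
  induction k with
  | zero => simp [state]
  | succ k ih =>
    rw [state, ih, Finset.sum_range_succ', ← Matrix.mulVecLin_apply S.A, map_sum]
    congr 1
    · refine Finset.sum_congr rfl fun p _ => ?_
      rw [Matrix.mulVecLin_apply, Matrix.mulVec_mulVec, ← Matrix.mul_assoc, ← pow_succ',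
        show k + 1 - 1 - (p + 1) = k - 1 - p by omega]
    · simp

lemma ioMap_eq_sum (S : SSM nu ny) (u : Sequence T nu) (k : Fin T) :
    S.ioMap u k = ∑ p ∈ Finset.range k, (S.C * S.A ^ p * S.B) *ᵥ
      (if h : (k : ℕ) - 1 - p < T then u ⟨k - 1 - p, h⟩ else 0) + S.D *ᵥ u k := by
  rw [ioMap, state_eq_sum, ← Matrix.mulVecLin_apply S.C, map_sum]
  congr 1
  refine Finset.sum_congr rfl fun p _ => ?_
  rw [Matrix.mulVecLin_apply, Matrix.mulVec_mulVec, Matrix.mul_assoc]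

/-- The input-output map as a linear map. -/
def ioLinear (S : SSM nu ny) (T : ℕ) : Sequence T nu →ₗ[ℝ] Sequence T ny where
  toFun u := S.ioMap u
  map_add' u v := by
    funext k
    simp only [ioMap_eq_sum, Pi.add_apply, Matrix.mulVec_add]
    rw [add_add_add_comm, ← Finset.sum_add_distrib]
    congr 1
    refine Finset.sum_congr rfl fun p _ => ?_
    split_ifs <;> simp [Matrix.mulVec_add]
  map_smul' c u := by
    funext k
    simp only [ioMap_eq_sum, Pi.smul_apply, Matrix.mulVec_smul, RingHom.id_apply, smul_add,
      Finset.smul_sum]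
    congr 1
    refine Finset.sum_congr rfl fun p _ => ?_
    split_ifs <;> simp [Matrix.mulVec_smul]

lemma abs_mulVec_le_sum {m n : ℕ} (W : Matrix (Fin m) (Fin n) ℝ) {x : Fin n → ℝ} {R : ℝ}
    (hx : ∀ j, |x j| ≤ R) (i : Fin m) : |(W *ᵥ x) i| ≤ (∑ j, |W i j|) * R := by
  rw [Matrix.mulVec, dotProduct, Finset.sum_mul]
  refine (Finset.abs_sum_le_sum_abs _ _).trans (Finset.sum_le_sum fun j _ => ?_)
  rw [abs_mul]
  exact mul_le_mul_of_nonneg_left (hx j) (abs_nonneg _)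

/-- The `ℓ₁` norm bounds the gain from `ℓ^∞` to `ℓ^∞`. -/
lemma abs_ioMap_le (S : SSM nu ny) {K : ℝ} (hS : S.norm1 ≤ ENNReal.ofReal K) {u : Sequence T nu}
    {R : ℝ} (hR : 0 ≤ R) (hu : ∀ k j, |u k j| ≤ R) (k : Fin T) (j : Fin ny) :
    |S.ioMap u k j| ≤ |K| * R := by
  have h1 : (∑ l, |S.D j l|) + ∑ p ∈ Finset.range k, ∑ l, |(S.C * S.A ^ p * S.B) j l| ≤ |K| := by
    have e : ENNReal.ofReal ((∑ l, |S.D j l|) +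
        ∑ p ∈ Finset.range k, ∑ l, |(S.C * S.A ^ p * S.B) j l|) ≤ ENNReal.ofReal |K| := by
      rw [ENNReal.ofReal_add (by positivity) (by positivity),
        ENNReal.ofReal_sum_of_nonneg (s := Finset.range k) fun p _ => by positivity]
      refine le_trans ?_ ((le_iSup (fun i => rowL1 S.D i +
        ∑' k : ℕ, rowL1 (S.C * S.A ^ k * S.B) i) j).trans
          (hS.trans (ENNReal.ofReal_le_ofReal (le_abs_self K))))
      exact add_le_add le_rfl
        (ENNReal.sum_le_tsum (f := fun k : ℕ => rowL1 (S.C * S.A ^ k * S.B) j) _)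
    exact (ENNReal.ofReal_le_ofReal_iff (abs_nonneg K)).1 e
  refine le_trans ?_ (mul_le_mul_of_nonneg_right h1 hR)
  rw [ioMap_eq_sum, Pi.add_apply, Finset.sum_apply, add_comm, add_mul,
    Finset.sum_mul (Finset.range k)]
  refine (abs_add_le _ _).trans (add_le_add (abs_mulVec_le_sum _ (hu k) j) ?_)
  refine (Finset.abs_sum_le_sum_abs _ _).trans (Finset.sum_le_sum fun p _ => ?_)
  refine abs_mulVec_le_sum _ (fun l => ?_) j
  split_ifs with h
  · exact hu _ l
  · simpa using hR

end SSM

/-! ### Families of sequences and blocks -/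

/-- The version of `VecBound` for a family of `N`-tuples of sequences. -/
structure SeqBound {N T n : ℕ} {κ : Type} (C r B : ℝ) (Z : κ → Fin N → Sequence T n) : Prop where
  rad : RadBound C r fun (p : κ × Fin T × Fin n) i => Z p.1 i p.2.1 p.2.2
  bound : ∀ t i k j, |Z t i k j| ≤ B

namespace SeqBound

variable {N T n : ℕ} {κ : Type} {C r B : ℝ} {Z : κ → Fin N → Sequence T n}

/-- Linear functionals of sequences that are bounded by `K` with respect to the supremum norm. -/
lemma rad_linear (h : SeqBound C r B Z) {ι : Type} {K : ℝ} (hK : 0 ≤ K) (g : ι → κ)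
    (φ : ι → Sequence T n →ₗ[ℝ] ℝ)
    (hφ : ∀ p z R, 0 ≤ R → (∀ k j, |z k j| ≤ R) → |φ p z| ≤ K * R) :
    RadBound C (K * r) fun p i => φ p (Z (g p) i) :=
  h.rad.dominate hK fun s R hR ht p => by
    rw [← map_signSum]
    refine hφ p _ R hR fun k j => ?_
    rw [signSum_apply, signSum_apply]
    exact ht (g p, k, j)

lemma ssm (h : SeqBound C r B Z) {ny : ℕ} {K : ℝ} (S : κ → SSM n ny)
    (hS : ∀ t, (S t).norm1 ≤ ENNReal.ofReal K) :
    SeqBound C (|K| * r) (|K| * |B|) fun t i => (S t).ioMap (Z t i) := by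
  refine ⟨h.rad_linear (abs_nonneg K) (fun p : κ × Fin T × Fin ny => p.1)
    (fun p => LinearMap.proj p.2.2 ∘ₗ LinearMap.proj p.2.1 ∘ₗ (S p.1).ioLinear T)
    fun p z R hR hz => (S p.1).abs_ioMap_le (hS p.1) hR hz p.2.1 p.2.2, fun t i k j => ?_⟩
  exact (S t).abs_ioMap_le (hS t) (abs_nonneg B)
    (fun k j => (h.bound t i k j).trans (le_abs_self B)) k j

/-- A sequence of vectors as a family of vectors indexed by the times. -/
lemma vecBound (h : SeqBound C r B Z) :
    VecBound C r B fun (p : κ × Fin T) i => Z p.1 i p.2 :=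
  ⟨h.rad.reindex fun p : (Σ _ : κ × Fin T, Fin n) => (p.1.1, p.1.2, p.2),
    fun _ _ _ => h.bound _ _ _ _⟩

lemma of_vecBound (h : VecBound C r B fun (p : κ × Fin T) i => Z p.1 i p.2) : SeqBound C r B Z :=
  ⟨h.rad.reindex fun p : κ × Fin T × Fin n => ⟨(p.1, p.2.1), p.2.2⟩,
    fun t i k j => h.bound (t, k) i j⟩

lemma residual (h : SeqBound C r B Z) {C' r' B' α : ℝ} {Z' : κ → Fin N → Sequence T n}
    (h' : SeqBound C' r' B' Z') :
    SeqBound (C' + C) (2 * (|r'| + |(|α| * r)|)) (B' + |α| * B)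
      fun t i k => Z' t i k + α • Z t i k := by
  have e := h.rad.dominate (abs_nonneg α)
    (c := fun (p : κ × Fin T × Fin n) i => α * Z p.1 i p.2.1 p.2.2) fun s R hR ht p => by
      rw [signSum_mul_left, abs_mul]
      exact mul_le_mul_of_nonneg_left (ht p) (abs_nonneg α)
  refine ⟨h'.rad.add e, fun t i k j => ?_⟩
  refine (abs_add_le _ _).trans (add_le_add (h'.bound t i k j) ?_)
  rw [Pi.smul_apply, smul_eq_mul, abs_mul]
  exact mul_le_mul_of_nonneg_left (h.bound t i k j) (abs_nonneg α)

end SeqBound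

lemma exists_seqBound_block (K α : ℝ) (Λ : LayerBounds) (C r B : ℝ) : ∃ C' r' B' : ℝ,
    ∀ (ρ : ℝ → ℝ), Λ.Admissible ρ → ∀ (N T : ℕ) (κ : Type) (nu ny : ℕ) (b : κ → Block nu ny),
      (∀ t, (b t).ssm.norm1 ≤ ENNReal.ofReal K ∧ NonlinearLayer.Respects ρ Λ (b t).layer ∧
        (b t).α = α) →
      ∀ Z : κ → Fin N → Sequence T nu, SeqBound C r B Z →
        SeqBound C' r' B' fun t i => (b t).eval (Z t i) := by
  obtain ⟨C', r', B', h⟩ := exists_vecBound_layer Λ C (|K| * r) (|K| * |B|)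
  refine ⟨C' + C, 2 * (|r'| + |(|α| * r)|), B' + |α| * B,
    fun ρ hρ N T κ nu ny b hb Z hZ => ?_⟩
  have h1 := h ρ hρ N (κ × Fin T) ny nu (fun p => (b p.1).layer) (fun p => (hb p.1).2.1) _
    (hZ.ssm (fun t => (b t).ssm) fun t => (hb t).1).vecBound
  have h2 := hZ.residual (α := α) (SeqBound.of_vecBound
    (Z := fun t i k => (b t).layer.eval ((b t).ssm.ioMap (Z t i) k)) h1)
  have e : ∀ t i, (b t).eval (Z t i) = fun k =>
      (b t).layer.eval ((b t).ssm.ioMap (Z t i) k) + α • Z t i k := fun t i => by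
    funext k; rw [Block.eval, (hb t).2.2]
  simpa only [e] using h2

lemma exists_seqBound_blocks (K : ℝ) : ∀ (L : ℕ) (α : Fin L → ℝ) (Λ : Fin L → LayerBounds)
    (C r B : ℝ), ∃ C' r' B' : ℝ,
    ∀ (ρ : Fin L → ℝ → ℝ), (∀ l, (Λ l).Admissible (ρ l)) →
      ∀ (N T : ℕ) (κ : Type) (nu ny : ℕ) (b : κ → Fin L → Block nu ny),
      (∀ t l, (b t l).ssm.norm1 ≤ ENNReal.ofReal K ∧
        NonlinearLayer.Respects (ρ l) (Λ l) (b t l).layer ∧ (b t l).α = α l) →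
      ∀ Z : κ → Fin N → Sequence T nu, SeqBound C r B Z →
        SeqBound C' r' B' fun t i => Fin.foldl L (fun v l => (b t l).eval v) (Z t i) := by
  intro L
  induction L with
  | zero =>
    intro α Λ C r B
    exact ⟨C, r, B, fun ρ _ N T κ nu ny b _ Z hZ => by simpa only [Fin.foldl_zero] using hZ⟩
  | succ L ih =>
    intro α Λ C r B
    obtain ⟨C₁, r₁, B₁, h₁⟩ := exists_seqBound_block K (α 0) (Λ 0) C r B
    obtain ⟨C', r', B', h⟩ := ih (fun l => α l.succ) (fun l => Λ l.succ) C₁ r₁ B₁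
    refine ⟨C', r', B', fun ρ hρ N T κ nu ny b hb Z hZ => ?_⟩
    have := h (fun l => ρ l.succ) (fun l => hρ _) N T κ nu ny (fun t l => b t l.succ)
      (fun t l => hb t _) _ (h₁ (ρ 0) (hρ 0) N T κ nu ny (fun t => b t 0) (fun t => hb t 0) Z hZ)
    simpa only [Fin.foldl_succ] using this

/-! ### Encoder, pooling and decoder -/

/-- A sequence as a vector of a Euclidean space. -/
def seqToEuclidean (T n : ℕ) : Sequence T n →ₗ[ℝ] EuclideanSpace ℝ (Fin T × Fin n) where
  toFun u := WithLp.toLp 2 fun p => u p.1 p.2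
  map_add' _ _ := rfl
  map_smul' _ _ := rfl

lemma norm_seqToEuclidean {T n : ℕ} (u : Sequence T n) : ‖seqToEuclidean T n u‖ = l2SeqNorm u := by
  rw [EuclideanSpace.norm_eq, l2SeqNorm, Fintype.sum_prod_type]
  simp only [Real.norm_eq_abs, sq_abs]
  rfl

lemma abs_mulVec_le_norm22_mul {m n T : ℕ} (W : Matrix (Fin m) (Fin n) ℝ) (u : Sequence T n)
    (k : Fin T) (j : Fin m) : |(W *ᵥ u k) j| ≤ norm22 W * l2SeqNorm u := by
  have h1 : ‖WithLp.toLp 2 (W *ᵥ u k)‖ ≤ norm22 W * ‖WithLp.toLp 2 (u k)‖ :=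
    Matrix.l2_opNorm_mulVec W (WithLp.toLp 2 (u k))
  have h2 : ‖WithLp.toLp 2 (u k)‖ ≤ l2SeqNorm u := by
    rw [EuclideanSpace.norm_eq, l2SeqNorm]
    refine Real.sqrt_le_sqrt ?_
    simp only [Real.norm_eq_abs, sq_abs]
    exact Finset.single_le_sum (f := fun k => ∑ j, (u k j) ^ 2)
      (fun k _ => Finset.sum_nonneg fun j _ => sq_nonneg _) (Finset.mem_univ k)
  have h3 : 0 ≤ norm22 W := by
    let _ : NormedAddCommGroup (Matrix (Fin m) (Fin n) ℝ) := Matrix.instL2OpNormedAddCommGroup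
    exact norm_nonneg W
  exact (PiLp.norm_apply_le (WithLp.toLp 2 (W *ᵥ u k)) j).trans
    (h1.trans (mul_le_mul_of_nonneg_left h2 h3))

lemma abs_apply_le_norm22 {m n : ℕ} (W : Matrix (Fin m) (Fin n) ℝ) (i : Fin m) (j : Fin n) :
    |W i j| ≤ norm22 W := by
  have h := abs_mulVec_le_norm22_mul W (T := 1) (fun _ => Pi.single j 1) 0 i
  have e : l2SeqNorm (T := 1) (n := n) (fun _ => Pi.single j 1) = 1 := by
    simp [l2SeqNorm, Pi.single_apply]
  simpa [e] using h

/-- The base of the recursion over the blocks: encoded inputs, where the Rademacher suprema are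
controlled by the norm of a Rademacher sum in `ℓ²`. -/
lemma seqBound_encoder {N T nin nu : ℕ} {κ : Type} {K Ku : ℝ} (W : κ → Matrix (Fin nu) (Fin nin) ℝ)
    (hW : ∀ t, norm22 (W t) < K) (u : Fin N → Sequence T nin) (hu : ∀ i, l2SeqNorm (u i) ≤ Ku) :
    SeqBound 2 (|K| * |Ku|) (|K| * |Ku|) fun t i k => W t *ᵥ u i k := by
  have hW' : ∀ t, norm22 (W t) ≤ |K| := fun t => (hW t).le.trans (le_abs_self K)
  have hl : ∀ v : Sequence T nin, 0 ≤ l2SeqNorm v := fun v => Real.sqrt_nonneg _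
  have hu' : ∀ i, l2SeqNorm (u i) ≤ |Ku| := fun i => (hu i).trans (le_abs_self Ku)
  constructor
  · refine RadBound.of_norm_signSum_le (fun i => |K| • seqToEuclidean T nin (u i))
      (fun i => ?_) fun p s => ?_
    · rw [norm_smul, norm_seqToEuclidean, Real.norm_eq_abs, abs_abs]
      exact mul_le_mul_of_nonneg_left (hu' i) (abs_nonneg K)
    · rw [signSum_smul, norm_smul, ← map_signSum, norm_seqToEuclidean, Real.norm_eq_abs, abs_abs,
        signSum_mulVec, ← signSum_apply]
      exact (abs_mulVec_le_norm22_mul (W p.1) (signSum s u) p.2.1 p.2.2).trans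
        (mul_le_mul_of_nonneg_right (hW' p.1) (hl _))
  · intro t i k j
    exact (abs_mulVec_le_norm22_mul (W t) (u i) k j).trans
      (mul_le_mul (hW' t) (hu' i) (hl _) (abs_nonneg K))

lemma abs_pool_le {T n : ℕ} {z : Sequence T n} {R : ℝ} (hR : 0 ≤ R) (hz : ∀ k j, |z k j| ≤ R)
    (j : Fin n) : |pool z j| ≤ R := by
  have h1 : |∑ k, z k j| ≤ T * R := by
    refine (Finset.abs_sum_le_sum_abs _ _).trans ?_
    exact (Finset.sum_le_card_nsmul _ _ R fun k _ => hz k j).trans (by simp)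
  rw [pool, abs_mul, abs_of_nonneg (by positivity)]
  rcases T.eq_zero_or_pos with rfl | hT
  · simpa using hR
  · have : (0 : ℝ) < T := by exact_mod_cast hT
    calc 1 / (T : ℝ) * |∑ k, z k j| ≤ 1 / (T : ℝ) * (T * R) := by gcongr
      _ = R := by field_simp

/-- Pooling followed by a scalar decoder, as a linear functional. -/
noncomputable def poolDecoder (T : ℕ) {n : ℕ} (W : Matrix (Fin 1) (Fin n) ℝ) : Sequence T n →ₗ[ℝ] ℝ where
  toFun z := (W *ᵥ pool z) 0
  map_add' z z' := by
    have : pool (z + z') = pool z + pool z' := by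
      funext j; simp [pool, Finset.sum_add_distrib, mul_add]
    rw [this, Matrix.mulVec_add, Pi.add_apply]
  map_smul' c z := by
    have : pool (c • z) = c • pool z := by
      funext j; simp only [pool, Pi.smul_apply, smul_eq_mul, ← Finset.mul_sum]; ring
    rw [this, Matrix.mulVec_smul, Pi.smul_apply, RingHom.id_apply]

lemma abs_poolDecoder_le {T n : ℕ} {W : Matrix (Fin 1) (Fin n) ℝ} {K : ℝ} (hW : norm22 W < K)
    {z : Sequence T n} {R : ℝ} (hR : 0 ≤ R) (hz : ∀ k j, |z k j| ≤ R) :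
    |poolDecoder T W z| ≤ n * |K| * R := by
  refine (SSM.abs_mulVec_le_sum W (abs_pool_le hR hz) 0).trans
    (mul_le_mul_of_nonneg_right ?_ hR)
  refine (Finset.sum_le_card_nsmul _ _ |K| fun j _ => ?_).trans (by simp)
  exact (abs_apply_le_norm22 W 0 j).trans (hW.le.trans (le_abs_self K))

/-! ### Deep models -/

/-- The outputs of deep SSM models on bounded inputs, with constants that do not depend on the
length of the sequences, the number of inputs and the size of the family. -/
lemma exists_radBound_eval (L nu : ℕ) (P : ClassParams L) (Ku : ℝ) : ∃ C r B : ℝ,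
    ∀ (nin ny : ℕ) (𝓕 : Families nin nu ny 1 L) (ρ : Fin L → ℝ → ℝ), 𝓕.Satisfies P ρ →
      ∀ (κ : Type) (f : κ → Model nin nu ny 1 L), (∀ t, f t ∈ 𝓕.models P.α) →
      ∀ (N T : ℕ) (u : Fin N → Sequence T nin), (∀ i, l2SeqNorm (u i) ≤ Ku) →
        RadBound C r (fun t i => (f t).eval (u i) 0) ∧ ∀ t i, |(f t).eval (u i) 0| ≤ B := by
  obtain ⟨C, r, B, h⟩ := exists_seqBound_blocks P.K1 L P.α P.layer 2 (|P.KEnc| * |Ku|)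
    (|P.KEnc| * |Ku|)
  refine ⟨C, nu * |P.KDec| * r, nu * |P.KDec| * |B|, fun nin ny 𝓕 ρ h𝓕 κ f hf N T u hu => ?_⟩
  have h1 := h ρ h𝓕.admissible N T κ nu ny (fun t => (f t).block)
    (fun t l => ⟨h𝓕.norm1_le _ ((hf t).2.2 l).1, h𝓕.respects l _ ((hf t).2.2 l).2.1,
      ((hf t).2.2 l).2.2⟩) _
    (seqBound_encoder (fun t => (f t).enc) (fun t => h𝓕.encoder_lt _ (hf t).1) u hu)
  constructor
  · exact h1.rad_linear (by positivity) (fun t => t) (fun t => poolDecoder T (f t).dec)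
      fun t z R hR hz => abs_poolDecoder_le (h𝓕.decoder_lt _ (hf t).2.1) hR hz
  · intro t i
    exact abs_poolDecoder_le (h𝓕.decoder_lt _ (hf t).2.1) (abs_nonneg B)
      fun k j => (h1.bound t i k j).trans (le_abs_self B)

/-! ### Continuity of the models -/

lemma MLPWeights.continuous_eval {ρ : ℝ → ℝ} (hρ : Continuous ρ) {M m n : ℕ}
    (w : MLPWeights M m n) : Continuous (w.eval ρ) := by
  induction w with
  | output W b => exact (continuous_const.matrix_mulVec continuous_id).add continuous_const
  | hidden W b rest ih =>
    refine ih.comp (continuous_pi fun j => hρ.comp ?_)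
    exact (continuous_apply j).comp
      ((continuous_const.matrix_mulVec continuous_id).add continuous_const)

lemma continuous_gelu : Continuous gelu :=
  (LipschitzWith.of_dist_le_mul (K := 2) fun x y => by
    simpa [Real.dist_eq] using abs_gelu_sub_le x y).continuous

lemma NonlinearLayer.continuous_eval {ny nu : ℕ} {Λ : LayerBounds} {ρ : ℝ → ℝ}
    (hρ : Λ.Admissible ρ) {g : NonlinearLayer ny nu} (hg : NonlinearLayer.Respects ρ Λ g) :
    Continuous g.eval := by
  cases Λ <;> cases g
  · obtain ⟨rfl, rfl, -⟩ := hg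
    refine MLPWeights.continuous_eval ?_ _
    rcases hρ.2 with rfl | h
    · exact lipschitzWith_relu.continuous
    · exact h.lipschitz.continuous
  · exact hg.elim
  · exact hg.elim
  · obtain ⟨rfl, -⟩ := hg
    refine continuous_pi fun j => ?_
    refine (continuous_gelu.comp (continuous_apply _)).mul (hρ.lipschitz.continuous.comp ?_)
    exact (continuous_apply j).comp (continuous_const.matrix_mulVec
      (continuous_pi fun i => continuous_gelu.comp (continuous_apply i)))

lemma Block.continuous_eval {nu ny T : ℕ} {b : Block nu ny} (hb : Continuous b.layer.eval) :
    Continuous fun u : Sequence T nu => b.eval u := by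
  have h : Continuous fun u : Sequence T nu => b.ssm.ioMap u :=
    (b.ssm.ioLinear T).continuous_of_finiteDimensional
  refine continuous_pi fun k => (hb.comp ((continuous_apply k).comp h)).add ?_
  exact (continuous_apply k).const_smul b.α

lemma continuous_foldl_eval {nu ny T : ℕ} : ∀ {L : ℕ} {b : Fin L → Block nu ny}
    (_ : ∀ l, Continuous (b l).layer.eval),
    Continuous fun u : Sequence T nu => Fin.foldl L (fun v l => (b l).eval v) u := by
  intro L
  induction L with
  | zero => intro b _; simpa only [Fin.foldl_zero] using! continuous_id
  | succ L ih =>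
    intro b hb
    simp only [Fin.foldl_succ]
    exact (ih (b := fun l => b l.succ) fun l => hb _).comp (Block.continuous_eval (hb 0))

lemma Model.continuous_eval {nin nu ny L T : ℕ} {P : ClassParams L}
    {𝓕 : Families nin nu ny 1 L} {ρ : Fin L → ℝ → ℝ} (h𝓕 : 𝓕.Satisfies P ρ)
    {f : Model nin nu ny 1 L} (hf : f ∈ 𝓕.models P.α) :
    Continuous fun u : Sequence T nin => f.eval u 0 := by
  have h1 : Continuous fun u : Sequence T nin => fun k => f.enc *ᵥ u k :=
    continuous_pi fun k => continuous_const.matrix_mulVec (continuous_apply k)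
  have h2 := continuous_foldl_eval (T := T) (b := f.block) fun l =>
    NonlinearLayer.continuous_eval (h𝓕.admissible l) (h𝓕.respects l _ (hf.2.2 l).2.1)
  exact (poolDecoder T f.dec).continuous_of_finiteDimensional.comp (h2.comp h1)

/-! ### Reduction to countable classes -/

/-- Every family of continuous functions has a countable subfamily that is dense for pointwise
convergence of sequences, since the compact-open topology is second countable. -/
lemma exists_countable_pointwise_dense {α X : Type*} [TopologicalSpace X]
    [SecondCountableTopology X] [LocallyCompactSpace X] (e : α → X → ℝ)
    (he : ∀ a, Continuous (e a)) :
    ∃ s : Set α, s.Countable ∧ ∀ a, ∃ g : ℕ → α, (∀ n, g n ∈ s) ∧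
      ∀ x, Filter.Tendsto (fun n => e (g n) x) Filter.atTop (nhds (e a x)) := by
  let ι : α → C(X, ℝ) := fun a => ⟨e a, he a⟩
  let _ : TopologicalSpace α := TopologicalSpace.induced ι inferInstance
  have : SecondCountableTopology α := TopologicalSpace.secondCountableTopology_induced α C(X, ℝ) ι
  obtain ⟨s, hs, hd⟩ := TopologicalSpace.exists_countable_dense α
  refine ⟨s, hs, fun a => ?_⟩
  obtain ⟨g, hg, hlim⟩ := mem_closure_iff_seq_limit.1 (hd a)
  refine ⟨g, hg, fun x => ?_⟩
  have h1 : Continuous fun a => ι a x := (continuous_eval_const x).comp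
    continuous_induced_dom
  exact (h1.tendsto a).comp hlim

/-! ### The loss -/

namespace IsLipschitzLoss

variable {ℓ : ℝ → ℝ → ℝ} {Lℓ : ℝ}

lemma abs_sub_le (h : IsLipschitzLoss ℓ Lℓ) (y₁ y₁' y₂ y₂' : ℝ) :
    |ℓ y₁ y₁' - ℓ y₂ y₂'| ≤ |Lℓ| * (|y₁ - y₂| + |y₁' - y₂'|) := by
  have e : Lℓ * (|y₁ - y₂| + |y₁' - y₂'|) ≤ |Lℓ| * (|y₁ - y₂| + |y₁' - y₂'|) :=
    mul_le_mul_of_nonneg_right (le_abs_self _) (by positivity)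
  have h1 := h.lipschitz y₁ y₁' y₂ y₂'
  have h2 := h.lipschitz y₂ y₂' y₁ y₁'
  rw [abs_sub_comm y₂, abs_sub_comm y₂'] at h2
  exact abs_le.2 ⟨by linarith, by linarith⟩

lemma abs_le (h : IsLipschitzLoss ℓ Lℓ) (y y' : ℝ) : |ℓ y y'| ≤ |Lℓ| * (|y| + |y'|) := by
  simpa [(h.eq_zero_iff 0 0).2 rfl] using h.abs_sub_le y y' 0 0

lemma continuous (h : IsLipschitzLoss ℓ Lℓ) : Continuous fun p : ℝ × ℝ => ℓ p.1 p.2 := by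
  refine (LipschitzWith.of_dist_le_mul (K := Real.toNNReal (|Lℓ| * 2)) fun p q => ?_).continuous
  rw [Real.dist_eq, Real.coe_toNNReal _ (by positivity)]
  refine (h.abs_sub_le p.1 p.2 q.1 q.2).trans ?_
  have h1 : |p.1 - q.1| ≤ dist p q := le_max_left _ _
  have h2 : |p.2 - q.2| ≤ dist p q := le_max_right _ _
  rw [mul_assoc]
  exact mul_le_mul_of_nonneg_left (by linarith) (abs_nonneg _)

/-- The losses of a class of predictions on fixed labels: contraction after subtracting the loss of
the zero prediction. -/
lemma radBound (h : IsLipschitzLoss ℓ Lℓ) {N : ℕ} {τ : Type*} {a : τ → Fin N → ℝ} {C r Ky : ℝ}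
    (ha : RadBound C r a) {y : Fin N → ℝ} (hy : ∀ i, |y i| ≤ Ky) :
    RadBound (2 * C + 2) (2 * (|(|Lℓ| * r)| + |(1 * (|Lℓ| * Ky))|))
      fun t i => ℓ (a t i) (y i) := by
  have h1 := ha.contraction_mul (abs_nonneg Lℓ) (c := fun t i => ℓ (a t i) (y i) - ℓ 0 (y i))
    (fun t i => by simpa using h.abs_sub_le (a t i) (y i) 0 (y i))
    (fun t t' i => by simpa using h.abs_sub_le (a t i) (y i) (a t' i) (y i))
  have h2 := h1.add_const_mul (RadBound.of_bounded (K := |Lℓ| * Ky) (fun i => ℓ 0 (y i)) fun i => by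
    refine (h.abs_le 0 (y i)).trans (mul_le_mul_of_nonneg_left ?_ (abs_nonneg _))
    simpa using hy i) (fun _ => 1) (fun _ => abs_one.le) zero_le_one
  simpa using h2

end IsLipschitzLoss

/-! ### Uniform deviations and empirical risk minimization -/

/-- The event that empirical and true losses are uniformly close over the whole class. -/
lemma exists_event_deviation_le (L nu : ℕ) (P : ClassParams L) (Lℓ Ku Ky : ℝ) :
    ∃ C r : ℝ, 1 ≤ C ∧ 0 < r ∧
      ∀ (nin ny : ℕ) (𝓕 : Families nin nu ny 1 L) (ρ : Fin L → ℝ → ℝ)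
        (F : Set (Model nin nu ny 1 L)) (ℓ : ℝ → ℝ → ℝ),
        𝓕.Satisfies P ρ → F ⊆ 𝓕.models P.α → IsLipschitzLoss ℓ Lℓ →
        ∀ (T : ℕ) (D : Measure (Sequence T nin × ℝ)), IsProbabilityMeasure D →
          BoundedData D Ku Ky → ∀ (N : ℕ), 0 < N → ∀ (δ : ℝ), 0 < δ → δ < 1 →
          ∃ G : Set (Fin N → Sequence T nin × ℝ), MeasurableSet G ∧
            ENNReal.ofReal (1 - δ) ≤ Measure.pi (fun _ : Fin N => D) G ∧
            ∀ S ∈ G, ∀ f ∈ F, |empLoss ℓ S f - trueLoss ℓ D f| ≤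
              8 * r * Real.sqrt (Real.log (2 * C / δ)) / Real.sqrt N := by
  obtain ⟨C₀, r₀, B, hCr⟩ := exists_radBound_eval L nu P Ku
  set C := max (2 * C₀ + 2) 1
  set r := |2 * (|(|Lℓ| * r₀)| + |(1 * (|Lℓ| * Ky))|)| + 1
  refine ⟨C, r, le_max_right _ _, by positivity, ?_⟩
  intro nin ny 𝓕 ρ F ℓ h𝓕 hF hℓ T D hD hbd N hN δ hδ hδ1
  -- data outside of the bounded set are replaced by a fixed point of it
  set A : Set (Sequence T nin × ℝ) := {p | l2SeqNorm p.1 ≤ Ku ∧ |p.2| ≤ Ky} with hA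
  have hAm : MeasurableSet A := by
    have h1 : Continuous fun p : Sequence T nin × ℝ => l2SeqNorm p.1 := by
      unfold l2SeqNorm
      fun_prop
    have h2 : Continuous fun p : Sequence T nin × ℝ => |p.2| := by fun_prop
    exact ((isClosed_le h1 continuous_const).inter
      (isClosed_le h2 continuous_const)).measurableSet
  obtain ⟨p₀, hp₀⟩ : ∃ p, p ∈ A := hbd.exists
  classical
  set π : Sequence T nin × ℝ → Sequence T nin × ℝ := fun p => if p ∈ A then p else p₀ with hπ
  have hπm : Measurable π := Measurable.ite hAm measurable_id measurable_const
  have hπA : ∀ p, π p ∈ A := fun p => by by_cases h : p ∈ A <;> simp [hπ, h, hp₀]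
  have hπid : ∀ p ∈ A, π p = p := fun p h => by simp [hπ, h]
  have hcont : ∀ f : F, Continuous fun u : Sequence T nin => f.1.eval u 0 :=
    fun f => Model.continuous_eval h𝓕 (hF f.2)
  obtain ⟨s, hs, hdense⟩ := exists_countable_pointwise_dense
    (fun (f : F) (u : Sequence T nin) => f.1.eval u 0) hcont
  have : Countable s := hs.to_subtype
  set h : F → Sequence T nin × ℝ → ℝ := fun f p => sampleLoss ℓ f.1 (π p) with hh
  have hmeas : ∀ f, Measurable (h f) := fun f =>
    (hℓ.continuous.comp (((hcont f).comp continuous_fst).prodMk continuous_snd)).measurable.comp hπm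
  have hbound : ∀ f p, |h f p| ≤ |Lℓ| * (B + Ky) := by
    intro f p
    have h1 := (hCr nin ny 𝓕 ρ h𝓕 Unit (fun _ => f.1) (fun _ => hF f.2) 1 T (fun _ => (π p).1)
      fun _ => (hπA p).1).2 () 0
    exact (hℓ.abs_le _ _).trans
      (mul_le_mul_of_nonneg_left (add_le_add h1 (hπA p).2) (abs_nonneg _))
  have hrad : ∀ S : Fin N → Sequence T nin × ℝ, RadBound C r fun (f : s) i => h f.1 (S i) := by
    intro S
    have h1 := (hCr nin ny 𝓕 ρ h𝓕 s (fun f => f.1.1) (fun f => hF f.1.2) N T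
      (fun i => (π (S i)).1) fun i => (hπA _).1).1
    refine (hℓ.radBound h1 (y := fun i => (π (S i)).2) fun i => (hπA _).2).mono
      (le_max_left _ _) ?_
    exact (le_add_of_nonneg_right zero_le_one).trans (le_abs_self _)
  have hdev := measure_exists_deviation_le (τ := s) D (fun f => hmeas f.1) (fun f => hbound f.1)
    (le_max_right _ _) (by positivity) hN hrad hδ hδ1
  set ε := 8 * r * Real.sqrt (Real.log (2 * C / δ)) / Real.sqrt N
  set μ := Measure.pi (fun _ : Fin N => D)
  set G : Set (Fin N → Sequence T nin × ℝ) := {S | (∀ i, S i ∈ A) ∧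
    ∀ f : s, |(1 / (N : ℝ)) * ∑ i, h f.1 (S i) - ∫ x, h f.1 x ∂D| ≤ ε} with hG
  have hGm : MeasurableSet G := by
    refine MeasurableSet.inter ?_ ?_
    · exact measurableSet_setOfPred.2 (Measurable.forall fun i =>
        measurableSet_setOfPred.1 (measurable_pi_apply i hAm))
    · refine measurableSet_setOfPred.2 (Measurable.forall fun f =>
        measurableSet_setOfPred.1 (measurableSet_le ?_ measurable_const))
      refine Measurable.abs (Measurable.sub_const (Measurable.const_mul ?_ _) _)
      exact Finset.measurable_sum _ fun i _ => (hmeas f.1).comp (measurable_pi_apply i)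
  have hae : ∀ᵐ S ∂μ, ∀ i, S i ∈ A := ae_all_iff.2 fun i =>
    (measurePreserving_eval (fun _ : Fin N => D) i).quasiMeasurePreserving.ae hbd
  refine ⟨G, hGm, ?_, ?_⟩
  · have hcompl : μ Gᶜ ≤ ENNReal.ofReal δ := by
      refine (measure_mono_ae ?_).trans hdev
      filter_upwards [hae] with S hS hSG
      by_contra hcon
      refine hSG ⟨hS, fun f => ?_⟩
      by_contra hf
      exact hcon ⟨f, not_le.1 hf⟩
    rw [ENNReal.ofReal_sub 1 hδ.le, ENNReal.ofReal_one, tsub_le_iff_right]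
    have : μ G + μ Gᶜ = 1 := by rw [measure_add_measure_compl hGm, measure_univ]
    rw [← this]
    exact add_le_add le_rfl hcompl
  · intro S hS f hf
    have htrue : ∀ f : F, trueLoss ℓ D f.1 = ∫ x, h f x ∂D := fun f =>
      integral_congr_ae (by
        filter_upwards [hbd] with p hp
        rw [hh]
        simp only
        rw [hπid p hp])
    have hemp : ∀ f : F, empLoss ℓ S f.1 = (1 / (N : ℝ)) * ∑ i, h f (S i) := fun f => by
      rw [empLoss]
      congr 1
      refine Finset.sum_congr rfl fun i _ => ?_
      rw [hh]
      simp only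
      rw [hπid _ (hS.1 i)]
    obtain ⟨g, hgs, hglim⟩ := hdense ⟨f, hf⟩
    have hlim : ∀ p, Filter.Tendsto (fun n => h (g n) p) Filter.atTop (nhds (h ⟨f, hf⟩ p)) :=
      fun p => (hℓ.continuous.tendsto _).comp ((hglim (π p).1).prodMk_nhds tendsto_const_nhds)
    have hint : Filter.Tendsto (fun n => ∫ x, h (g n) x ∂D) Filter.atTop
        (nhds (∫ x, h ⟨f, hf⟩ x ∂D)) :=
      tendsto_integral_of_dominated_convergence (fun _ => |Lℓ| * (B + Ky))
        (fun n => (hmeas _).aestronglyMeasurable) (integrable_const _)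
        (fun n => ae_of_all _ fun p => hbound _ p) (ae_of_all _ hlim)
    have hsum : Filter.Tendsto (fun n => (1 / (N : ℝ)) * ∑ i, h (g n) (S i)) Filter.atTop
        (nhds ((1 / (N : ℝ)) * ∑ i, h ⟨f, hf⟩ (S i))) :=
      (tendsto_finsetSum _ fun i _ => hlim (S i)).const_mul _
    have e1 := htrue ⟨f, hf⟩
    have e2 := hemp ⟨f, hf⟩
    simp only at e1 e2
    rw [e1, e2]
    exact le_of_tendsto (hsum.sub hint).abs
      (Filter.Eventually.of_forall fun n => hS.2 ⟨g n, hgs n⟩)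

end DeepSSM

theorem corollary1 (L nu : ℕ) (P : DeepSSM.ClassParams L) (Lℓ Ku Ky : ℝ) :
    ∃ KF Kl : ℝ, 0 ≤ KF ∧ 0 ≤ Kl ∧
      ∀ (nin ny : ℕ) (𝓕 : DeepSSM.Families nin nu ny 1 L) (ρ : Fin L → ℝ → ℝ)
        (F : Set (DeepSSM.Model nin nu ny 1 L)) (ℓ : ℝ → ℝ → ℝ),
        𝓕.Satisfies P ρ → F ⊆ 𝓕.models P.α → DeepSSM.IsLipschitzLoss ℓ Lℓ →
        ∀ (T : ℕ), 0 < T →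
        ∀ (D : MeasureTheory.Measure (DeepSSM.Sequence T nin × ℝ)),
          MeasureTheory.IsProbabilityMeasure D → DeepSSM.BoundedData D Ku Ky →
        ∀ (N : ℕ), 0 < N → ∀ (δ : ℝ), 0 < δ →
          ∃ G : Set (Fin N → DeepSSM.Sequence T nin × ℝ), MeasurableSet G ∧
            ENNReal.ofReal (1 - δ) ≤ MeasureTheory.Measure.pi (fun _ : Fin N => D) G ∧
            ∀ S ∈ G, ∀ fERM : DeepSSM.Model nin nu ny 1 L, DeepSSM.IsERM ℓ F S fERM →
              DeepSSM.trueLoss ℓ D fERM ≤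
                sInf (DeepSSM.trueLoss ℓ D '' F)
                  + (KF + 5 * Kl * Real.sqrt (2 * Real.log (8 / δ))) / Real.sqrt (N : ℝ) := by
  obtain ⟨C, r, hC, hr, h⟩ := DeepSSM.exists_event_deviation_le L nu P Lℓ Ku Ky
  refine ⟨16 * r * Real.sqrt (Real.log (2 * C)), 16 * r, by positivity, by positivity, ?_⟩
  intro nin ny 𝓕 ρ F ℓ h𝓕 hF hℓ T _ D hD hbd N hN δ hδ
  rcases le_or_gt 1 δ with hδ1 | hδ1
  · refine ⟨∅, MeasurableSet.empty, ?_, fun S hS => hS.elim⟩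
    rw [ENNReal.ofReal_of_nonpos (by linarith)]
    exact zero_le
  obtain ⟨G, hGm, hG, hdev⟩ := h nin ny 𝓕 ρ F ℓ h𝓕 hF hℓ T D hD hbd N hN δ hδ hδ1
  refine ⟨G, hGm, hG, fun S hS f hf => ?_⟩
  set ε := 8 * r * Real.sqrt (Real.log (2 * C / δ)) / Real.sqrt N with hε
  have hsub : DeepSSM.trueLoss ℓ D f - 2 * ε ≤ sInf (DeepSSM.trueLoss ℓ D '' F) := by
    refine le_csInf ⟨_, Set.mem_image_of_mem _ hf.1⟩ ?_
    rintro _ ⟨g, hg, rfl⟩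
    have h1 := (abs_le.1 (hdev S hS f hf.1)).1
    have h2 := (abs_le.1 (hdev S hS g hg)).2
    linarith [hf.2 g hg]
  have hlog : Real.sqrt (Real.log (2 * C / δ)) ≤
      Real.sqrt (Real.log (2 * C)) + 5 * Real.sqrt (2 * Real.log (8 / δ)) := by
    have l1 : 0 ≤ Real.log (2 * C) := Real.log_nonneg (by linarith)
    have l2 : 0 ≤ Real.log (8 / δ) := Real.log_nonneg (by rw [le_div_iff₀ hδ]; linarith)
    have l3 : Real.log (2 * C / δ) ≤ Real.log (2 * C) + Real.log (8 / δ) := by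
      rw [← Real.log_mul (by positivity) (by positivity)]
      refine Real.log_le_log (by positivity) ?_
      rw [← mul_div_assoc]
      exact div_le_div_of_nonneg_right (by linarith) hδ.le
    refine Real.sqrt_le_iff.2 ⟨by positivity, l3.trans ?_⟩
    have s1 := Real.sq_sqrt l1
    have s2 := Real.sq_sqrt (mul_nonneg zero_le_two l2)
    nlinarith [mul_nonneg (Real.sqrt_nonneg (Real.log (2 * C)))
      (Real.sqrt_nonneg (2 * Real.log (8 / δ)))]
  have hfin : 2 * ε ≤ (16 * r * Real.sqrt (Real.log (2 * C)) +
      5 * (16 * r) * Real.sqrt (2 * Real.log (8 / δ))) / Real.sqrt N := by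
    rw [hε, ← mul_div_assoc]
    refine div_le_div_of_nonneg_right ?_ (Real.sqrt_nonneg _)
    nlinarith [mul_le_mul_of_nonneg_left hlog (by positivity : 0 ≤ 16 * r)]
  linarith
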